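/- Let $q$ be a power of $2$ and let $n\ge 1$. Let $Q$ be a quadratic form on a $2n$-dimensional vector space $V$ over the field $\mathbb{F}_q$ whose polar form $(x,y)\mapsto Q(x+y)-Q(x)-Q(y)$ is nondegenerate. Say that $Q$ has type $+$ if its Witt index (the largest dimension of a subspace on which $Q$ vanishes identically) is $n$, and type $-$ if its Witt index is $n-1$. For $Q$ of type $\pm$, let $O^{\pm}_{2n}(q)$ be the full isometry group of $Q$, and let $p^{\pm}_{2n}(m)$ be the probability that a uniformly random element of $O^{\pm}_{2n}(q)$ has a fixed space in $V$ of dimension $m$. Write $|GL_k(q^2)|$ for the order of the group of invertible $k\times k$ matrices over the field with $q^2$ elements (so $|GL_0(q^2)|=1$). Empty products are $1$ and empty sums are $0$. 1. For $0\le k\le n$, \begin{align*} p_{2n}^{\pm}(2k) ={}& \frac{q^k}{2|GL_k(q^2)|}\sum_{j=0}^{n-k}\frac{(-1)^j}{q^{(2k-1)j}(q^{2j}-1)\cdots(q^4-1)(q^2-1)}\\ &\pm\frac12\cdot\frac{(-1)^{n-k}}{q^{2k(n-k)}\,|GL_k(q^2)|\,(q^{2(n-k)}-1)\cdots(q^4-1)(q^2-1)}.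 \end{align*} 2. For every integer $k\ge 0$ and for both types, $$p_{2n}^{\pm}(2k+1)=\frac{1}{2q^k|GL_k(q^2)|}\sum_{j=0}^{n-k-1}\frac{(-1)^j}{q^{j^2+2(k+1)j}(1-1/q^2)(1-1/q^4)\cdots(1-1/q^{2j})},$$ where the sum is empty if $k\ge n$. -/

import Mathlib

noncomputable section

namespace EvenOrthogonal

variable {F V : Type*} [Field F] [AddCommGroup V] [Module F V]

/-- The full orthogonal group (isometry group) of the quadratic form `Q`: the linear
automorphisms `g` of `V` with `Q (g v) = Q v` for all `v`. -/
def orthogonalGroup (Q : QuadraticForm F V) : Subgroup (V ≃ₗ[F] V) where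
  carrier := {g | ∀ v, Q (g v) = Q v}
  mul_mem' {a b} ha hb v := by
    change Q (a (b v)) = Q v
    rw [ha, hb]
  one_mem' v := rfl
  inv_mem' {a} ha v := by
    change Q (a.symm v) = Q v
    rw [← ha (a.symm v), LinearEquiv.apply_symm_apply]

/-- A subspace is totally singular if `Q` vanishes identically on it. -/
def IsTotallySingular (Q : QuadraticForm F V) (W : Submodule F V) : Prop :=
  ∀ w ∈ W, Q w = 0

/-- The Witt index of `Q`: the largest dimension of a totally singular subspace. -/
def wittIndex (Q : QuadraticForm F V) : ℕ :=
  sSup {d | ∃ W : Submodule F V, IsTotallySingular Q W ∧ Module.finrank F W = d}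

/-- `Q` is a form of plus type on a space of dimension `2n`: its polar form
`(x, y) ↦ Q (x + y) - Q x - Q y` is nondegenerate and its Witt index is `n`.
The isometry group of such a form is `O⁺_{2n}(F)`. -/
structure IsPlusType (Q : QuadraticForm F V) (n : ℕ) : Prop where
  finrank_eq : Module.finrank F V = 2 * n
  nondegenerate : Q.polarBilin.Nondegenerate
  wittIndex_eq : wittIndex Q = n

/-- `Q` is a form of minus type on a space of dimension `2n`: its polar form
is nondegenerate and its Witt index is `n - 1`.
The isometry group of such a form (over a finite field `F`) is `O⁻_{2n}(F)`. -/
structure IsMinusType (Q : QuadraticForm F V) (n : ℕ) : Prop where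
  finrank_eq : Module.finrank F V = 2 * n
  nondegenerate : Q.polarBilin.Nondegenerate
  wittIndex_eq : wittIndex Q + 1 = n

/-- The probability that a uniformly random element of the orthogonal group of `Q` (over a finite
field, on a finite-dimensional space) has a fixed space of dimension `k`. -/
def fixedSpaceProb (Q : QuadraticForm F V) (k : ℕ) : ℚ :=
  (Nat.card {g : orthogonalGroup Q //
      Module.finrank F (LinearMap.fixedSubmodule (g : V ≃ₗ[F] V).toLinearMap) = k} : ℚ) /
    (Nat.card (orthogonalGroup Q) : ℚ)

end EvenOrthogonal

end

/-!
Let `B` be the polar form of `Q`, a nondegenerate quadratic form of Witt index `a` on a space `V` of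
dimension `a + b + 1` over a field with `q` elements. The plus type is `(a, b) = (n, n - 1)`, the
minus type is `(a, b) = (n - 1, n)`, and both are treated at once.

**Wall forms.** An isometry `g` is determined by the range `W` of `1 - g` together with the bilinear
form `χ` on `W` given by `χ (x - g x) v = B x v`. The forms that occur are exactly the nondegenerate
ones with `χ w w = Q w` (`card_moveRange_eq`). So the number of isometries with an `m`-dimensional
fixed space is the number of such pairs `(W, χ)` with `dim W = dim V - m`.

**Counting forms.** The forms on `W` with diagonal `Q` whose left kernel contains a given
`l`-dimensional subspace `L` exist only if `L` is totally singular, and then there are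
`q ^ ((dim W - l).choose 2)` of them (`card_diagForms_le_ker`). Inclusion–exclusion over the left
kernel gives the number of nondegenerate ones, and summing over `W` with the `q`-binomial theorem
expresses `∑ g, u ^ rank (1 - g)` through the numbers of totally singular subspaces
(`sum_orthogonalGroup_pow`). The latter follow from the number of singular vectors orthogonal to a
totally singular subspace `Z`, and this is easy because `Q` is equidistributed off the orthogonal
complement of `Z` (`card_mul_card_singular_not_mem_orthogonal`, `card_singularTuples`).

**Moments.** For `m < n` the resulting polynomial in `u` vanishes at `-q ^ (-m)`, and at `q ^ (-m)`
it has a product value (`rankPoly_neg`, `rankPoly_inv_pow`). Hence the even and the odd part of the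
distribution of `d = dim ker (1 - g)` each contribute `1 / 2 * ∏ i ∈ Icc 1 m, (1 + q ^ i)` to the
mean of `q ^ (m d)`. The claimed probabilities have the same moments, by Möbius inversion in base
`q ^ 2` and a Rogers–Szegő evaluation (`sum_evenProb_mul_pow`, `sum_oddProb_mul_pow`). As only the
identity fixes all of `V`, the probability of `d = 2 n` is the inverse of the group order, and the remaining
`n` even and `n` odd probabilities are determined by `n` moments each (Vandermonde).
-/

namespace EvenOrthogonal

open Finset

/-! ### Gaussian binomial coefficients -/

/-- The product `(q - 1) (q ^ 2 - 1) ⋯ (q ^ n - 1)`. -/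
def qProd (q : ℚ) (n : ℕ) : ℚ := ∏ i ∈ range n, (q ^ (i + 1) - 1)

/-- The Gaussian binomial coefficient, defined by its Pascal recursion. -/
def gaussBinom (q : ℚ) : ℕ → ℕ → ℚ
  | _, 0 => 1
  | 0, _ + 1 => 0
  | n + 1, k + 1 => gaussBinom q n k + q ^ (k + 1) * gaussBinom q n (k + 1)

@[simp] lemma gaussBinom_zero_right (q : ℚ) (n : ℕ) : gaussBinom q n 0 = 1 := by
  cases n <;> rfl

lemma gaussBinom_succ_succ (q : ℚ) (n k : ℕ) :
    gaussBinom q (n + 1) (k + 1) =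
      gaussBinom q n k + q ^ (k + 1) * gaussBinom q n (k + 1) := rfl

lemma gaussBinom_eq_zero_of_lt (q : ℚ) {n k : ℕ} (h : n < k) : gaussBinom q n k = 0 := by
  induction n generalizing k with
  | zero => obtain ⟨k, rfl⟩ := Nat.exists_eq_succ_of_ne_zero (by omega : k ≠ 0); rfl
  | succ n ih =>
    obtain ⟨k, rfl⟩ := Nat.exists_eq_succ_of_ne_zero (by omega : k ≠ 0)
    rw [Nat.succ_eq_add_one, gaussBinom_succ_succ, ih (by omega), ih (by omega)]
    simp

@[simp] lemma gaussBinom_self (q : ℚ) (n : ℕ) : gaussBinom q n n = 1 := by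
  induction n with
  | zero => rfl
  | succ n ih => rw [gaussBinom_succ_succ, ih, gaussBinom_eq_zero_of_lt q n.lt_succ_self]; simp

lemma qProd_succ (q : ℚ) (n : ℕ) : qProd q (n + 1) = qProd q n * (q ^ (n + 1) - 1) :=
  prod_range_succ _ _

@[simp] lemma qProd_zero (q : ℚ) : qProd q 0 = 1 := rfl

lemma qProd_pos {q : ℚ} (hq : 1 < q) (n : ℕ) : 0 < qProd q n :=
  prod_pos fun i _ => sub_pos.2 (one_lt_pow₀ hq i.succ_ne_zero)

lemma gaussBinom_mul_qProd (q : ℚ) (k j : ℕ) :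
    gaussBinom q (k + j) k * (qProd q k * qProd q j) = qProd q (k + j) := by
  induction k generalizing j with
  | zero => simp
  | succ k ih =>
    induction j with
    | zero => simp
    | succ j ihj =>
      have h1 := ih (j + 1)
      have e : k + 1 + (j + 1) = (k + (j + 1)) + 1 := by ring
      have e' : k + 1 + j = k + (j + 1) := by ring
      rw [e'] at ihj
      rw [e, gaussBinom_succ_succ, qProd_succ q (k + (j + 1)), qProd_succ q k, qProd_succ q j]
      rw [qProd_succ q j] at h1
      rw [qProd_succ q k] at ihj
      generalize gaussBinom q (k + (j + 1)) k = A at *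
      generalize gaussBinom q (k + (j + 1)) (k + 1) = B at *
      generalize qProd q (k + (j + 1)) = C at *
      rw [show k + (j + 1) + 1 = (k + 1) + (j + 1) by ring, pow_add q (k + 1) (j + 1)]
      linear_combination (q ^ (k + 1) - 1) * h1 + q ^ (k + 1) * (q ^ (j + 1) - 1) * ihj

lemma gaussBinom_eq_div {q : ℚ} (hq : 1 < q) {n k : ℕ} (h : k ≤ n) :
    gaussBinom q n k = qProd q n / (qProd q k * qProd q (n - k)) := by
  obtain ⟨j, rfl⟩ := Nat.exists_eq_add_of_le h
  rw [Nat.add_sub_cancel_left, eq_div_iff (mul_pos (qProd_pos hq _) (qProd_pos hq _)).ne',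
    gaussBinom_mul_qProd]

lemma gaussBinom_symm {q : ℚ} (hq : 1 < q) {n k : ℕ} (h : k ≤ n) :
    gaussBinom q n (n - k) = gaussBinom q n k := by
  rw [gaussBinom_eq_div hq h, gaussBinom_eq_div hq (Nat.sub_le _ _), Nat.sub_sub_self h, mul_comm]

/-- The second form of the Pascal recursion. -/
lemma gaussBinom_succ_succ' {q : ℚ} (hq : 1 < q) {n k : ℕ} (h : k ≤ n) :
    gaussBinom q (n + 1) (k + 1) =
      q ^ (n - k) * gaussBinom q n k + gaussBinom q n (k + 1) := by
  rcases h.eq_or_lt with rfl | h'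
  · simp [gaussBinom_eq_zero_of_lt q k.lt_succ_self]
  · rw [← gaussBinom_symm hq (by omega : k + 1 ≤ n + 1), ← gaussBinom_symm hq h,
      ← gaussBinom_symm hq (by omega : k + 1 ≤ n)]
    obtain ⟨j, rfl⟩ := Nat.exists_eq_add_of_lt h'
    rw [show k + j + 1 + 1 - (k + 1) = j + 1 by omega, show k + j + 1 - k = j + 1 by omega,
      show k + j + 1 - (k + 1) = j by omega, gaussBinom_succ_succ]
    ring

/-- The `q`-binomial theorem. -/
theorem sum_gaussBinom_mul_pow (q z : ℚ) (n : ℕ) :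
    ∑ k ∈ range (n + 1), gaussBinom q n k * q ^ k.choose 2 * z ^ k =
      ∏ i ∈ range n, (1 + z * q ^ i) := by
  induction n generalizing z with
  | zero => simp
  | succ n ih =>
    have hs : ∑ k ∈ range (n + 1), gaussBinom q n (k + 1) * q ^ (k + 1).choose 2 * (q * z) ^ (k + 1)
        = ∏ i ∈ range n, (1 + q * z * q ^ i) - 1 := by
      rw [← ih, sum_range_succ, sum_range_succ' _ n, gaussBinom_eq_zero_of_lt q n.lt_succ_self]
      simp
    rw [sum_range_succ', prod_range_succ']
    have h1 : ∀ k ∈ range (n + 1),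
        gaussBinom q (n + 1) (k + 1) * q ^ (k + 1).choose 2 * z ^ (k + 1) =
          z * (gaussBinom q n k * q ^ k.choose 2 * (q * z) ^ k) +
          gaussBinom q n (k + 1) * q ^ (k + 1).choose 2 * (q * z) ^ (k + 1) := by
      intro k _
      rw [gaussBinom_succ_succ, Nat.choose_succ_succ' k 1, Nat.choose_one_right, pow_add, mul_pow,
        mul_pow]
      ring
    rw [sum_congr rfl h1, sum_add_distrib, ← mul_sum, ih, hs]
    have h2 : ∀ i ∈ range n, 1 + z * q ^ (i + 1) = 1 + q * z * q ^ i := fun i _ => by ring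
    rw [prod_congr rfl h2]
    simp
    ring

lemma prod_pow_sub_one_mul_qProd (q : ℚ) (d j : ℕ) :
    (∏ i ∈ range d, (q ^ (d + j - i) - 1)) * qProd q j = qProd q (d + j) := by
  induction d with
  | zero => simp
  | succ d ih =>
    rw [prod_range_succ', add_right_comm, qProd_succ, ← ih]
    simp only [Nat.add_sub_add_right, Nat.sub_zero]
    ring

/-- The number of linearly independent `d`-tuples in an `N`-dimensional space, in terms of the
Gaussian binomial coefficient. -/
lemma prod_pow_sub_pow {q : ℚ} (hq : 1 < q) (d N : ℕ) :
    ∏ i ∈ range d, (q ^ N - q ^ i) = q ^ d.choose 2 * qProd q d * gaussBinom q N d := by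
  rcases lt_or_ge N d with h | h
  · rw [gaussBinom_eq_zero_of_lt q h, mul_zero, prod_eq_zero (mem_range.2 h) (sub_self _)]
  · obtain ⟨j, rfl⟩ := Nat.exists_eq_add_of_le h
    have h1 : ∏ i ∈ range d, (q ^ (d + j) - q ^ i) =
        q ^ d.choose 2 * ∏ i ∈ range d, (q ^ (d + j - i) - 1) := by
      have : q ^ d.choose 2 = ∏ i ∈ range d, q ^ i := by
        rw [prod_pow_eq_pow_sum, sum_range_id, Nat.choose_two_right]
      rw [this, ← prod_mul_distrib]
      refine prod_congr rfl fun i hi => ?_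
      have := mem_range.1 hi
      rw [mul_sub, ← pow_add, Nat.add_sub_cancel' (by omega), mul_one]
    have h2 := prod_pow_sub_one_mul_qProd q d j
    have h3 := gaussBinom_mul_qProd q d j
    have h4 := (qProd_pos hq j).ne'
    rw [h1, mul_assoc]
    congr 1
    rw [← mul_left_inj' h4, h2, ← h3]
    ring

/-- A weighted count of linearly independent tuples that detects the zero space, which has
dimension `u = 0`. -/
lemma sum_div_qProd_mul_prod {q : ℚ} (hq : 1 < q) {u N : ℕ} (h : u ≤ N) :
    ∑ l ∈ range (N + 1), (-1) ^ l / qProd q l * ∏ i ∈ range l, (q ^ u - q ^ i) =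
      if u = 0 then 1 else 0 := by
  have h1 : ∀ l, (-1) ^ l / qProd q l * ∏ i ∈ range l, (q ^ u - q ^ i) =
      gaussBinom q u l * q ^ l.choose 2 * (-1) ^ l := fun l => by
    rw [prod_pow_sub_pow hq]
    have := (qProd_pos hq l).ne'
    field_simp
  simp_rw [h1]
  have h2 := sum_gaussBinom_mul_pow q (-1) u
  rw [← sum_subset (range_mono (Nat.succ_le_succ h)), h2]
  · rcases u with _ | u
    · simp
    · rw [if_neg (Nat.succ_ne_zero u)]
      exact prod_eq_zero (mem_range.2 u.succ_pos) (by simp)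
  · intro l _ hl
    rw [gaussBinom_eq_zero_of_lt q (by simpa using hl)]
    simp

lemma sum_range_reflect' (f : ℕ → ℚ) (m : ℕ) :
    ∑ a ∈ range (m + 1), f (m - a) = ∑ a ∈ range (m + 1), f a := by
  rw [← sum_range_reflect f (m + 1)]
  rfl

/-- The Rogers–Szegő polynomial of base `q ^ 2` takes a product value at `q`. -/
lemma sum_gaussBinom_sq_mul_pow {q : ℚ} (hq : 1 < q) (m : ℕ) :
    ∑ a ∈ range (m + 1), q ^ a * gaussBinom (q ^ 2) m a = ∏ i ∈ range m, (1 + q ^ (i + 1)) := by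
  have hq2 : 1 < q ^ 2 := one_lt_pow₀ hq two_ne_zero
  have hq0 : q ≠ 0 := (zero_lt_one.trans hq).ne'
  induction m with
  | zero => simp
  | succ m ih =>
    rw [prod_range_succ, ← ih, sum_range_succ']
    have h1 : ∀ a ∈ range (m + 1), q ^ (a + 1) * gaussBinom (q ^ 2) (m + 1) (a + 1) =
        q ^ (m + 1) * (q ^ (m - a) * gaussBinom (q ^ 2) m (m - a)) +
          q ^ (a + 1) * gaussBinom (q ^ 2) m (a + 1) := by
      intro a ha
      have ha' : a ≤ m := Nat.lt_succ_iff.1 (mem_range.1 ha)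
      rw [gaussBinom_succ_succ' hq2 ha', gaussBinom_symm hq2 ha']
      obtain ⟨j, rfl⟩ := Nat.exists_eq_add_of_le ha'
      rw [Nat.add_sub_cancel_left]
      ring
    rw [sum_congr rfl h1, sum_add_distrib, ← mul_sum,
      sum_range_reflect' (fun a => q ^ a * gaussBinom (q ^ 2) m a) m]
    have h2 : ∑ a ∈ range (m + 1), q ^ (a + 1) * gaussBinom (q ^ 2) m (a + 1) + 1 =
        ∑ a ∈ range (m + 1), q ^ a * gaussBinom (q ^ 2) m a := by
      rw [sum_range_succ, gaussBinom_eq_zero_of_lt _ m.lt_succ_self,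
        sum_range_succ' (fun a => q ^ a * gaussBinom (q ^ 2) m a)]
      simp
    simp only [pow_zero, gaussBinom_zero_right, mul_one]
    rw [add_assoc, h2]
    ring

lemma sum_inv_pow_mul_gaussBinom_sq {q : ℚ} (hq : 1 < q) (m : ℕ) :
    q ^ m * ∑ a ∈ range (m + 1), (q ^ a)⁻¹ * gaussBinom (q ^ 2) m a =
      ∏ i ∈ range m, (1 + q ^ (i + 1)) := by
  have hq2 : 1 < q ^ 2 := one_lt_pow₀ hq two_ne_zero
  have hq0 : q ≠ 0 := (zero_lt_one.trans hq).ne'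
  rw [← sum_gaussBinom_sq_mul_pow hq,
    ← sum_range_reflect' (fun a => q ^ a * gaussBinom (q ^ 2) m a) m, mul_sum]
  refine sum_congr rfl fun a ha => ?_
  have ha' : a ≤ m := Nat.lt_succ_iff.1 (mem_range.1 ha)
  rw [gaussBinom_symm hq2 ha', ← mul_assoc]
  congr 1
  rw [← div_eq_mul_inv, pow_sub₀ q hq0 ha', div_eq_mul_inv]

/-! ### The rank polynomial at powers of `q` -/

/-- For a space of dimension `a + b + 1` with Witt index `a`, this is the sum of `u ^ (rank (1 - g))`
over all isometries `g` (see `sum_orthogonalGroup_pow_finrank`). -/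
def rankPoly (q : ℚ) (a b : ℕ) (u : ℚ) : ℚ :=
  ∑ l ∈ range (a + 1), (-1) ^ l * (gaussBinom q a l * q ^ l.choose 2) * u ^ l *
    (∏ i ∈ range l, (q ^ (b - i) + 1)) * ∏ i ∈ range (a + b + 1 - l), (1 + u * q ^ i)

lemma rankPoly_neg {q : ℚ} (hq : 1 < q) {a b m : ℕ} (hm : m ≤ b) :
    rankPoly q a b (-(q ^ m)⁻¹) = 0 := by
  have hq0 : q ≠ 0 := (zero_lt_one.trans hq).ne'
  refine sum_eq_zero fun l hl => ?_
  have hl' := mem_range.1 hl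
  have h : ∏ i ∈ range (a + b + 1 - l), (1 + -(q ^ m)⁻¹ * q ^ i) = 0 := by
    refine prod_eq_zero (i := m) (mem_range.2 (by omega)) ?_
    rw [neg_mul, inv_mul_cancel₀ (pow_ne_zero _ hq0), add_neg_cancel]
  rw [h, mul_zero]

lemma prod_one_sub_inv_pow {q : ℚ} (hq : 1 < q) (a : ℕ) :
    q ^ (a + 1).choose 2 * ∏ i ∈ range a, (1 - (q ^ a)⁻¹ * q ^ i) = qProd q a := by
  have hq0 : q ≠ 0 := (zero_lt_one.trans hq).ne'
  have e : q ^ (a + 1).choose 2 = ∏ i ∈ range a, q ^ (i + 1) := by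
    rw [prod_pow_eq_pow_sum, Nat.choose_two_right, ← sum_range_id, sum_range_succ', add_zero]
  rw [e, ← prod_range_reflect (fun i => 1 - (q ^ a)⁻¹ * q ^ i), ← prod_mul_distrib, qProd]
  refine prod_congr rfl fun i hi => ?_
  have hi' := mem_range.1 hi
  obtain ⟨j, rfl⟩ := Nat.exists_eq_add_of_lt hi'
  rw [show i + j + 1 - 1 - i = j by omega]
  field_simp
  ring

lemma prod_one_add_inv_pow {q : ℚ} (hq : 1 < q) (m : ℕ) :
    q ^ (m + 1).choose 2 * ∏ i ∈ range m, (1 + (q ^ m)⁻¹ * q ^ i) =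
      ∏ i ∈ range m, (1 + q ^ (i + 1)) := by
  have hq0 : q ≠ 0 := (zero_lt_one.trans hq).ne'
  have e : q ^ (m + 1).choose 2 = ∏ i ∈ range m, q ^ (i + 1) := by
    rw [prod_pow_eq_pow_sum, Nat.choose_two_right, ← sum_range_id, sum_range_succ', add_zero]
  rw [e, ← prod_range_reflect (fun i => 1 + (q ^ m)⁻¹ * q ^ i), ← prod_mul_distrib]
  refine prod_congr rfl fun i hi => ?_
  have hi' := mem_range.1 hi
  obtain ⟨j, rfl⟩ := Nat.exists_eq_add_of_lt hi'
  rw [show i + j + 1 - 1 - i = j by omega]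
  field_simp
  ring

/-- The two products in a summand of `rankPoly` combine to a product whose last factor is, as a
function of `l`, a polynomial of degree `a - m` in `q ^ (-l)`. -/
lemma prod_mul_prod_eq {q : ℚ} (hq : 1 < q) {a b m l : ℕ} (hma : m ≤ a) (hla : l ≤ a)
    (hab : a ≤ b + 1) :
    (∏ i ∈ range l, (q ^ (b - i) + 1)) * ∏ i ∈ range (a + b + 1 - l), (1 + (q ^ m)⁻¹ * q ^ i) =
      (∏ i ∈ range m, (1 + (q ^ m)⁻¹ * q ^ i)) * (∏ i ∈ range (b + 1), (1 + q ^ i)) *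
        ∏ i ∈ range (a - m), (1 + q ^ (b + 1 - l) * q ^ i) := by
  have hq0 : q ≠ 0 := (zero_lt_one.trans hq).ne'
  obtain ⟨c, hc⟩ : ∃ c, b + 1 = c + l := ⟨b + 1 - l, by omega⟩
  rw [show a + b + 1 - l = m + (c + (a - m)) by omega, prod_range_add _ m, prod_range_add _ c,
    hc, prod_range_add _ c l, Nat.add_sub_cancel]
  have h1 : ∏ x ∈ range c, (1 + (q ^ m)⁻¹ * q ^ (m + x)) = ∏ x ∈ range c, (1 + q ^ x) :=
    prod_congr rfl fun i _ => by rw [pow_add]; field_simp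
  have h2 : ∏ x ∈ range (a - m), (1 + (q ^ m)⁻¹ * q ^ (m + (c + x))) =
      ∏ x ∈ range (a - m), (1 + q ^ c * q ^ x) :=
    prod_congr rfl fun i _ => by rw [pow_add, pow_add]; field_simp
  have h3 : ∏ x ∈ range l, (1 + q ^ (c + x)) = ∏ i ∈ range l, (q ^ (b - i) + 1) := by
    rw [← prod_range_reflect]
    refine prod_congr rfl fun i hi => ?_
    have := mem_range.1 hi
    rw [show c + (l - 1 - i) = b - i by omega, add_comm]
  rw [h1, h2, h3]
  ring

/-- The value of `rankPoly` at `q ^ (-m)`: once the products are expanded by the `q`-binomial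
theorem and the order of summation is reversed, all inner sums but one vanish. -/
theorem rankPoly_inv_pow {q : ℚ} (hq : 1 < q) {a b m : ℕ} (hma : m ≤ a) (hab : a ≤ b + 1) :
    rankPoly q a b (q ^ m)⁻¹ =
      q ^ (a * b) * (∏ i ∈ range (b + 1), (1 + q ^ i)) * qProd q a *
        (∏ i ∈ range m, (1 + q ^ (i + 1))) * ((q ^ m)⁻¹) ^ (a + b + 1) := by
  have hq0 : q ≠ 0 := (zero_lt_one.trans hq).ne'
  set P := ∏ i ∈ range m, (1 + (q ^ m)⁻¹ * q ^ i) with hP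
  set G := ∏ i ∈ range (b + 1), (1 + q ^ i) with hG
  have h1 : rankPoly q a b (q ^ m)⁻¹ = ∑ l ∈ range (a + 1), ∑ j ∈ range (a - m + 1),
      P * G * (gaussBinom q (a - m) j * q ^ j.choose 2 * (q ^ (b + 1)) ^ j) *
        (gaussBinom q a l * q ^ l.choose 2 * (-(q ^ (m + j))⁻¹) ^ l) := by
    refine sum_congr rfl fun l hl => ?_
    have hl' : l ≤ a := Nat.lt_succ_iff.1 (mem_range.1 hl)
    rw [mul_assoc, prod_mul_prod_eq hq hma hl' hab, ← hP, ← hG, ← sum_gaussBinom_mul_pow, mul_sum,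
      mul_sum]
    refine sum_congr rfl fun j _ => ?_
    obtain ⟨c, hc⟩ : ∃ c, b + 1 = l + c := ⟨b + 1 - l, by omega⟩
    rw [hc, Nat.add_sub_cancel_left, neg_pow ((q ^ (m + j))⁻¹) l, pow_add q m j, pow_add q l c,
      inv_pow, inv_pow, mul_pow, mul_pow, ← pow_mul q j l, ← pow_mul q l j, mul_comm l j]
    field_simp
  rw [h1, sum_comm]
  simp_rw [← mul_sum, sum_gaussBinom_mul_pow]
  rw [sum_eq_single (a - m)]
  · rw [Nat.add_sub_cancel' hma]
    have e1 := prod_one_sub_inv_pow hq a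
    have e2 := prod_one_add_inv_pow hq m
    have e3 : ∏ i ∈ range a, (1 + -(q ^ a)⁻¹ * q ^ i) = ∏ i ∈ range a, (1 - (q ^ a)⁻¹ * q ^ i) :=
      prod_congr rfl fun i _ => by ring
    rw [e3, ← e1, ← e2, ← hP, gaussBinom_self]
    have e4 : (a - m).choose 2 + (b + 1) * (a - m) + m * (a + b + 1) =
        a * b + (a + 1).choose 2 + (m + 1).choose 2 := by
      obtain ⟨c, rfl⟩ := Nat.exists_eq_add_of_le hma
      rw [Nat.add_sub_cancel_left]
      have : (((c.choose 2 + (b + 1) * c + m * (m + c + b + 1) : ℕ)) : ℚ) =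
          (((m + c) * b + (m + c + 1).choose 2 + (m + 1).choose 2 : ℕ) : ℚ) := by
        push_cast [Nat.cast_choose_two]
        ring
      exact_mod_cast this
    have e5 : q ^ (a - m).choose 2 * (q ^ (b + 1)) ^ (a - m) * (q ^ m) ^ (a + b + 1) =
        q ^ (a * b) * q ^ (a + 1).choose 2 * q ^ (m + 1).choose 2 := by
      simp only [← pow_mul, ← pow_add, e4]
    rw [inv_pow]
    have h0 : (q ^ m) ^ (a + b + 1) ≠ 0 := by positivity
    rw [← mul_left_inj' h0, mul_assoc _ ((q ^ m) ^ (a + b + 1))⁻¹, inv_mul_cancel₀ h0]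
    linear_combination P * G * (∏ i ∈ range a, (1 - (q ^ a)⁻¹ * q ^ i)) * e5
  · intro j hj hne
    have hj' := mem_range.1 hj
    rw [prod_eq_zero (i := m + j) (mem_range.2 (by omega)), mul_zero]
    rw [neg_mul, inv_mul_cancel₀ (pow_ne_zero _ hq0), add_neg_cancel]
  · intro h
    exact absurd (mem_range.2 (Nat.lt_succ_self _)) h

/-! ### Moments of the claimed probabilities -/

/-- The order of `GL_k` over a field with `q` elements. -/
def glOrder (q : ℚ) (k : ℕ) : ℚ := q ^ k.choose 2 * qProd q k

lemma glOrder_pos {q : ℚ} (hq : 1 < q) (k : ℕ) : 0 < glOrder q k :=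
  mul_pos (pow_pos (zero_lt_one.trans hq) _) (qProd_pos hq k)

lemma pow_choose_mul_gaussBinom_div_glOrder {q : ℚ} (hq : 1 < q) (k j : ℕ) :
    q ^ j.choose 2 * gaussBinom q (k + j) k / glOrder q (k + j) =
      1 / (q ^ (k * j) * glOrder q k * qProd q j) := by
  have h0 := zero_lt_one.trans hq
  have h1 := qProd_pos hq k
  have h2 := qProd_pos hq j
  have h3 := qProd_pos hq (k + j)
  have e : q ^ (k + j).choose 2 = q ^ k.choose 2 * q ^ j.choose 2 * q ^ (k * j) := by
    rw [← pow_add, ← pow_add]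
    congr 1
    have : (((k + j).choose 2 : ℕ) : ℚ) = ((k.choose 2 + j.choose 2 + k * j : ℕ) : ℚ) := by
      push_cast [Nat.cast_choose_two]
      ring
    exact_mod_cast this
  rw [glOrder, glOrder, e, div_eq_div_iff (by positivity) (by positivity),
    ← gaussBinom_mul_qProd q k j]
  ring

/-- A `q`-analogue of Möbius inversion: the moments of a sequence that is given by alternating
sums. -/
lemma sum_sum_div_mul_pow {q : ℚ} (hq : 1 < q) (M : ℕ → ℚ) (N m : ℕ) :
    ∑ k ∈ range N, (∑ j ∈ range (N - k),
        (-1) ^ j * M (k + j) / (q ^ (k * j) * glOrder q k * qProd q j)) * (q ^ m) ^ k =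
      ∑ a ∈ range N, M a * gaussBinom q m a := by
  have h0 := zero_lt_one.trans hq
  simp_rw [sum_mul]
  rw [← sum_range_diag_flip N (fun k j =>
    (-1) ^ j * M (k + j) / (q ^ (k * j) * glOrder q k * qProd q j) * (q ^ m) ^ k)]
  refine sum_congr rfl fun a _ => ?_
  have hX : q ^ m ≠ 0 := pow_ne_zero _ h0.ne'
  have h1 : ∀ k ∈ range (a + 1),
      (-1) ^ (a - k) * M (k + (a - k)) / (q ^ (k * (a - k)) * glOrder q k * qProd q (a - k)) *
        (q ^ m) ^ k =
      M a / glOrder q a * (q ^ m) ^ a * (gaussBinom q a (a - k) * q ^ (a - k).choose 2 *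
        (-(q ^ m)⁻¹) ^ (a - k)) := by
    intro k hk
    have hk' : k ≤ a := Nat.lt_succ_iff.1 (mem_range.1 hk)
    rw [gaussBinom_symm hq hk']
    obtain ⟨j, rfl⟩ := Nat.exists_eq_add_of_le hk'
    rw [Nat.add_sub_cancel_left, div_eq_mul_one_div, ← pow_choose_mul_gaussBinom_div_glOrder hq,
      pow_add (q ^ m), neg_pow ((q ^ m)⁻¹), inv_pow]
    have := (glOrder_pos hq (k + j)).ne'
    field_simp
  rw [sum_congr rfl h1, ← mul_sum, sum_range_reflect' (fun j => gaussBinom q a j * q ^ j.choose 2 *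
    (-(q ^ m)⁻¹) ^ j), sum_gaussBinom_mul_pow]
  have h2 : (q ^ m) ^ a * ∏ i ∈ range a, (1 + -(q ^ m)⁻¹ * q ^ i) =
      ∏ i ∈ range a, (q ^ m - q ^ i) := by
    have : (q ^ m) ^ a = ∏ i ∈ range a, q ^ m := by simp
    rw [this, ← prod_mul_distrib]
    refine prod_congr rfl fun i _ => ?_
    field_simp
    ring
  rw [mul_assoc, h2, prod_pow_sub_pow hq, ← glOrder]
  have := (glOrder_pos hq a).ne'
  field_simp

/-- The claimed probability of a `2 k`-dimensional fixed space; `e` is `1` for plus type and `-1`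
for minus type. -/
def evenProb (q : ℚ) (n : ℕ) (e : ℚ) (k : ℕ) : ℚ :=
  q ^ k / (2 * glOrder (q ^ 2) k) * ∑ j ∈ range (n - k + 1),
      (-1) ^ j / (q ^ ((2 * (k : ℤ) - 1) * (j : ℤ)) * ∏ i ∈ Icc 1 j, (q ^ (2 * i) - 1)) +
    e * (1 / 2 * ((-1) ^ (n - k) / (q ^ (2 * k * (n - k)) * glOrder (q ^ 2) k *
      ∏ i ∈ Icc 1 (n - k), (q ^ (2 * i) - 1))))

/-- The claimed probability of a `2 k + 1`-dimensional fixed space. -/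
def oddProb (q : ℚ) (n k : ℕ) : ℚ :=
  1 / (2 * q ^ k * glOrder (q ^ 2) k) * ∑ j ∈ range (n - k),
    (-1) ^ j / (q ^ (j ^ 2 + 2 * (k + 1) * j) * ∏ i ∈ Icc 1 j, (1 - 1 / q ^ (2 * i)))

lemma prod_Icc_eq_qProd (q : ℚ) (j : ℕ) :
    ∏ i ∈ Icc 1 j, (q ^ (2 * i) - 1) = qProd (q ^ 2) j := by
  rw [qProd, range_eq_Ico, prod_Ico_add' (fun i => (q ^ 2) ^ i - 1) 0 j 1]
  exact prod_congr rfl fun i _ => by rw [pow_mul]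

lemma prod_Icc_one_sub_inv {q : ℚ} (hq : 1 < q) (j : ℕ) :
    q ^ (j * (j + 1)) * ∏ i ∈ Icc 1 j, (1 - 1 / q ^ (2 * i)) = qProd (q ^ 2) j := by
  have h0 : q ≠ 0 := (zero_lt_one.trans hq).ne'
  induction j with
  | zero => simp
  | succ j ih =>
    rw [prod_Icc_succ_top (by omega), qProd_succ, ← ih]
    field_simp
    ring

lemma evenProb_eq {q : ℚ} (hq : 1 < q) {n k : ℕ} (hk : k ≤ n) (e : ℚ) :
    evenProb q n e k = ∑ j ∈ range (n + 1 - k),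
      (-1) ^ j * ((q ^ (k + j) + if k + j = n then e else 0) / 2) /
        ((q ^ 2) ^ (k * j) * glOrder (q ^ 2) k * qProd (q ^ 2) j) := by
  have h0 := zero_lt_one.trans hq
  have hq2 : 1 < q ^ 2 := one_lt_pow₀ hq two_ne_zero
  have hG := glOrder_pos hq2 k
  rw [show n + 1 - k = n - k + 1 by omega, evenProb]
  simp_rw [add_div, mul_add, add_div, sum_add_distrib]
  congr 1
  · rw [mul_sum]
    refine sum_congr rfl fun j _ => ?_
    have h1 : q ^ ((2 * (k : ℤ) - 1) * (j : ℤ)) = (q ^ 2) ^ (k * j) / q ^ j := by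
      rw [sub_mul, zpow_sub₀ h0.ne', ← pow_mul]
      congr 1
      · rw [← zpow_natCast]
        push_cast
        ring_nf
      · simp
    have := qProd_pos hq2 j
    rw [h1, prod_Icc_eq_qProd, pow_add]
    field_simp
  · rw [sum_eq_single (n - k)]
    · have := qProd_pos hq2 (n - k)
      rw [if_pos (by omega), prod_Icc_eq_qProd, ← pow_mul, mul_assoc 2 k]
      field_simp
    · intro j _ hj
      rw [if_neg (by omega)]
      simp
    · intro h
      exact absurd (mem_range.2 (Nat.lt_succ_self _)) h

lemma oddProb_eq {q : ℚ} (hq : 1 < q) (n k : ℕ) :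
    oddProb q n k = ∑ j ∈ range (n - k), (-1) ^ j * ((q ^ (k + j))⁻¹ / 2) /
        ((q ^ 2) ^ (k * j) * glOrder (q ^ 2) k * qProd (q ^ 2) j) := by
  have h0 := zero_lt_one.trans hq
  have hq2 : 1 < q ^ 2 := one_lt_pow₀ hq two_ne_zero
  have hG := glOrder_pos hq2 k
  rw [oddProb, mul_sum]
  refine sum_congr rfl fun j _ => ?_
  have h2 := qProd_pos hq2 j
  have h1 := prod_Icc_one_sub_inv hq j
  have h3 : 0 < ∏ i ∈ Icc 1 j, (1 - 1 / q ^ (2 * i)) :=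
    pos_of_mul_pos_right (h1 ▸ h2) (by positivity)
  rw [← h1]
  field_simp
  ring

lemma sum_evenProb_mul_pow {q : ℚ} (hq : 1 < q) {n m : ℕ} (hm : m < n) (e : ℚ) :
    ∑ k ∈ range (n + 1), evenProb q n e k * (q ^ (2 * m)) ^ k =
      (∏ i ∈ range m, (1 + q ^ (i + 1))) / 2 := by
  have hq2 : 1 < q ^ 2 := one_lt_pow₀ hq two_ne_zero
  have h1 := sum_sum_div_mul_pow hq2 (fun a => (q ^ a + if a = n then e else 0) / 2) (n + 1) m
  rw [← sum_gaussBinom_sq_mul_pow hq, pow_mul]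
  rw [sum_congr rfl fun k hk => by rw [evenProb_eq hq (Nat.lt_succ_iff.1 (mem_range.1 hk))], h1,
    sum_div, ← sum_subset (range_mono (Nat.succ_le_succ hm.le))]
  · refine sum_congr rfl fun a ha => ?_
    have := mem_range.1 ha
    rw [if_neg (by omega)]
    ring
  · intro a _ ha
    rw [gaussBinom_eq_zero_of_lt _ (by simpa using ha), mul_zero]

lemma sum_oddProb_mul_pow {q : ℚ} (hq : 1 < q) {n m : ℕ} (hm : m < n) :
    q ^ m * ∑ k ∈ range n, oddProb q n k * (q ^ (2 * m)) ^ k =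
      (∏ i ∈ range m, (1 + q ^ (i + 1))) / 2 := by
  have hq2 : 1 < q ^ 2 := one_lt_pow₀ hq two_ne_zero
  have h1 := sum_sum_div_mul_pow hq2 (fun a => (q ^ a)⁻¹ / 2) n m
  rw [← sum_inv_pow_mul_gaussBinom_sq hq, pow_mul, mul_div_assoc]
  congr 1
  rw [sum_congr rfl fun k hk => by rw [oddProb_eq hq], h1, sum_div,
    ← sum_subset (range_mono (Nat.succ_le_of_lt hm))]
  · exact sum_congr rfl fun a _ => by ring
  · intro a _ ha
    rw [gaussBinom_eq_zero_of_lt _ (by simpa using ha), mul_zero]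

/-- A sequence of length `n` is determined by its first `n` moments. -/
lemma eq_of_sum_mul_pow_eq {q : ℚ} (hq : 1 < q) {n : ℕ} {f g : ℕ → ℚ}
    (h : ∀ m < n, ∑ k ∈ range n, f k * (q ^ (2 * m)) ^ k =
      ∑ k ∈ range n, g k * (q ^ (2 * m)) ^ k) {k : ℕ} (hk : k < n) : f k = g k := by
  have hinj : Function.Injective fun i : Fin n => q ^ (2 * (i : ℕ)) := fun i j hij => by
    have := pow_right_injective₀ (zero_lt_one.trans hq) hq.ne' hij
    exact Fin.ext (by simpa using this)
  have h0 : (fun i : Fin n => f i - g i) = 0 := by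
    refine Matrix.eq_zero_of_forall_pow_sum_mul_pow_eq_zero hinj fun m => ?_
    have hm := h m m.2
    rw [← Fin.sum_univ_eq_sum_range (fun k => f k * (q ^ (2 * (m : ℕ))) ^ k),
      ← Fin.sum_univ_eq_sum_range (fun k => g k * (q ^ (2 * (m : ℕ))) ^ k)] at hm
    rw [← sub_eq_zero, ← sum_sub_distrib] at hm
    rw [← hm]
    refine sum_congr rfl fun i _ => ?_
    rw [← sub_mul, ← pow_mul, ← pow_mul]
    congr 2
    ring
  have := congrFun h0 ⟨k, hk⟩
  simpa [sub_eq_zero] using this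

/-! ### Counting subspaces -/

section Subspaces

lemma card_eq_sum_card_fiber {α β : Type*} [Finite α] [Fintype β] (f : α → β) :
    Nat.card α = ∑ b, Nat.card {a // f a = b} := by
  rw [← Nat.card_sigma, Nat.card_congr (Equiv.sigmaFiberEquiv f)]

/-- Double counting of the pairs in a relation. -/
lemma sum_card_subtype_comm {α β : Type*} [Fintype α] [Fintype β] (r : α → β → Prop) :
    ∑ a, Nat.card {b // r a b} = ∑ b, Nat.card {a // r a b} := by
  rw [← Nat.card_sigma, ← Nat.card_sigma]
  exact Nat.card_congr ⟨fun p => ⟨p.2.1, p.1, p.2.2⟩, fun p => ⟨p.2.1, p.1, p.2.2⟩,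
    fun _ => rfl, fun _ => rfl⟩

lemma one_lt_card (F : Type*) [Field F] [Finite F] : (1 : ℚ) < Nat.card F := by
  exact_mod_cast Finite.one_lt_card

variable {F V : Type*} [Field F] [Finite F] [AddCommGroup V] [Module F V] [FiniteDimensional F V]

lemma card_linearIndependent_eq (l : ℕ) :
    (Nat.card {s : Fin l → V // LinearIndependent F s} : ℚ) =
      ∏ i ∈ range l, ((Nat.card F : ℚ) ^ Module.finrank F V - (Nat.card F : ℚ) ^ i) := by
  have := Fintype.ofFinite F
  have : Finite V := Module.finite_of_finite F
  rcases le_or_gt l (Module.finrank F V) with h | h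
  · rw [card_linearIndependent h, Nat.cast_prod, ← Fin.prod_univ_eq_prod_range]
    refine prod_congr rfl fun i _ => ?_
    rw [Nat.cast_sub (Nat.pow_le_pow_right Fintype.card_pos (by omega))]
    simp
  · rw [prod_eq_zero (mem_range.2 h) (sub_self _)]
    have : IsEmpty {s : Fin l → V // LinearIndependent F s} :=
      ⟨fun s => by have := s.2.fintype_card_le_finrank; simp at this; omega⟩
    simp

/-- Linearly independent tuples in a subspace, as tuples in the whole space. -/
def linearIndependentEquiv {l : ℕ} (W : Submodule F V) :
    {t : Fin l → W // LinearIndependent F t} ≃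
      {s : Fin l → V // LinearIndependent F s ∧ Submodule.span F (Set.range s) ≤ W} where
  toFun t := ⟨fun i => t.1 i, t.2.map' W.subtype W.ker_subtype, by
    rw [Submodule.span_le]
    rintro _ ⟨i, rfl⟩
    exact (t.1 i).2⟩
  invFun s := ⟨fun i => ⟨s.1 i, s.2.2 (Submodule.subset_span ⟨i, rfl⟩)⟩,
    LinearIndependent.of_comp W.subtype s.2.1⟩
  left_inv _ := rfl
  right_inv _ := rfl

/-- The number of `d`-dimensional subspaces. -/
lemma card_submodule_finrank_eq (d : ℕ) :
    (Nat.card {W : Submodule F V // Module.finrank F W = d} : ℚ) =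
      gaussBinom (Nat.card F) (Module.finrank F V) d := by
  have hq := one_lt_card F
  have : Finite V := Module.finite_of_finite F
  have := Fintype.ofFinite {W : Submodule F V // Module.finrank F W = d}
  let f : {s : Fin d → V // LinearIndependent F s} →
      {W : Submodule F V // Module.finrank F W = d} :=
    fun s => ⟨Submodule.span F (Set.range s.1), by simpa using finrank_span_eq_card s.2⟩
  have h1 := congrArg (Nat.cast : ℕ → ℚ) (card_eq_sum_card_fiber f)
  have h2 : ∀ W : {W : Submodule F V // Module.finrank F W = d},
      (Nat.card {s // f s = W} : ℚ) = glOrder (Nat.card F) d := by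
    intro W
    have e : {s // f s = W} ≃ {t : Fin d → W.1 // LinearIndependent F t} :=
      ((Equiv.subtypeSubtypeEquivSubtypeInter (fun s : Fin d → V => LinearIndependent F s)
          fun s => Submodule.span F (Set.range s) = W.1).symm.trans
        (Equiv.subtypeEquivRight fun s => by simp [f, Subtype.ext_iff])).symm.trans
      ((Equiv.subtypeEquivRight fun s => and_congr_right fun hs =>
        ⟨fun h => h.le, fun h => Submodule.eq_of_le_of_finrank_eq h
          (by rw [W.2]; simpa using finrank_span_eq_card hs)⟩).trans
      (linearIndependentEquiv W.1).symm)
    rw [Nat.card_congr e, card_linearIndependent_eq, W.2, prod_pow_sub_pow hq, gaussBinom_self,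
      glOrder, mul_one]
  rw [Nat.cast_sum, sum_congr rfl fun W _ => h2 W, card_linearIndependent_eq,
    prod_pow_sub_pow hq, ← glOrder, sum_const, nsmul_eq_mul, card_univ, ← Nat.card_eq_fintype_card,
    mul_comm] at h1
  exact mul_right_cancel₀ (glOrder_pos hq d).ne' h1.symm

lemma sum_submodule_pow [Fintype (Submodule F V)] (u : ℚ) :
    ∑ W : Submodule F V, u ^ Module.finrank F W *
        (Nat.card F : ℚ) ^ (Module.finrank F W).choose 2 =
      ∏ i ∈ range (Module.finrank F V), (1 + u * (Nat.card F : ℚ) ^ i) := by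
  classical
  rw [← sum_gaussBinom_mul_pow, ← sum_fiberwise_of_maps_to (s := univ)
    (t := range (Module.finrank F V + 1)) (g := fun W : Submodule F V => Module.finrank F W)
    fun W _ => mem_range.2 (Nat.lt_succ_of_le W.finrank_le)]
  refine sum_congr rfl fun d _ => ?_
  rw [← card_submodule_finrank_eq, Nat.card_eq_fintype_card (α := {W // _}), Fintype.card_subtype,
    sum_congr rfl (g := fun _ => u ^ d * (Nat.card F : ℚ) ^ d.choose 2)
      fun W hW => by rw [(mem_filter.1 hW).2], sum_const, nsmul_eq_mul]
  ring

/-- The sum of `sum_submodule_pow` for the quotient by `L`, as a sum over the subspaces that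
contain `L`. -/
lemma sum_submodule_ge_pow [Fintype (Submodule F V)] (L : Submodule F V) (u : ℚ)
    [DecidablePred fun W : Submodule F V => L ≤ W] :
    ∑ W : Submodule F V with L ≤ W, u ^ Module.finrank F W *
        (Nat.card F : ℚ) ^ (Module.finrank F W - Module.finrank F L).choose 2 =
      u ^ Module.finrank F L *
        ∏ i ∈ range (Module.finrank F V - Module.finrank F L), (1 + u * (Nat.card F : ℚ) ^ i) := by
  have : Finite V := Module.finite_of_finite F
  have : Finite (V ⧸ L) := Module.finite_of_finite F
  have := Fintype.ofFinite (Submodule F (V ⧸ L))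
  have hf : ∀ p : Submodule F (V ⧸ L),
      Module.finrank F (p.comap L.mkQ) = Module.finrank F L + Module.finrank F p := by
    intro p
    have h1 := (L.mkQ.domRestrict (p.comap L.mkQ)).finrank_range_add_finrank_ker
    have h2 : LinearMap.range (L.mkQ.domRestrict (p.comap L.mkQ)) = p := by
      rw [LinearMap.range_domRestrict, Submodule.map_comap_eq, Submodule.range_mkQ, top_inf_eq]
    have h3 : LinearMap.ker (L.mkQ.domRestrict (p.comap L.mkQ)) =
        L.comap (p.comap L.mkQ).subtype := by
      rw [LinearMap.ker_domRestrict, Submodule.ker_mkQ]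
    have h4 : L ≤ p.comap L.mkQ := by
      intro x hx
      simp [(Submodule.Quotient.mk_eq_zero L).2 hx]
    rw [h2, h3, (Submodule.comapSubtypeEquivOfLe h4).finrank_eq] at h1
    omega
  rw [← Submodule.finrank_quotient, ← sum_submodule_pow, mul_sum]
  symm
  refine sum_bij (fun p _ => p.comap L.mkQ) ?_ ?_ ?_ ?_
  · intro p _
    simp only [mem_filter, mem_univ, true_and]
    intro x hx
    simp [(Submodule.Quotient.mk_eq_zero L).2 hx]
  · intro p _ p' _ h
    exact Submodule.comap_injective_of_surjective L.mkQ_surjective h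
  · intro W hW
    refine ⟨W.map L.mkQ, mem_univ _, ?_⟩
    rw [Submodule.comap_map_eq, Submodule.ker_mkQ, sup_eq_left]
    exact (mem_filter.1 hW).2
  · intro p _
    rw [hf, Nat.add_sub_cancel_left, pow_add]
    ring

end Subspaces

/-! ### Bilinear forms with a given diagonal -/

section BilinearForms

variable {F V : Type*} [Field F] [AddCommGroup V] [Module F V]

/-- Bilinear forms, not assumed symmetric, whose diagonal is the given quadratic form. -/
def diagForms (φ : QuadraticForm F V) : Set (LinearMap.BilinForm F V) :=
  {χ | ∀ v, χ v v = φ v}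

lemma add_flip_of_mem_diagForms {φ : QuadraticForm F V} {χ : LinearMap.BilinForm F V}
    (h : χ ∈ diagForms φ) (v w : V) : χ v w + χ w v = φ.polarBilin v w := by
  have h1 := h (v + w)
  simp only [map_add, LinearMap.add_apply, h v, h w] at h1
  simp only [QuadraticMap.polarBilin_apply_apply, QuadraticMap.polar]
  rw [← h1]
  ring

/-- In a basis, a bilinear form with given diagonal amounts to its entries above the diagonal. -/
lemma bijective_diagForms_entries {r : ℕ} (b : Module.Basis (Fin r) F V) (φ : QuadraticForm F V) :
    Function.Bijective fun (χ : diagForms φ) (p : {p : Fin r × Fin r // p.1 < p.2}) =>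
      χ.1 (b p.1.1) (b p.1.2) := by
  constructor
  · intro χ χ' h
    have hlt : ∀ i j, i < j → χ.1 (b i) (b j) = χ'.1 (b i) (b j) := fun i j hij =>
      congrFun h ⟨(i, j), hij⟩
    refine Subtype.ext (LinearMap.BilinForm.ext_basis b fun i j => ?_)
    rcases lt_trichotomy i j with hij | rfl | hij
    · exact hlt i j hij
    · rw [χ.2, χ'.2]
    · have h1 := add_flip_of_mem_diagForms χ.2 (b i) (b j)
      have h2 := add_flip_of_mem_diagForms χ'.2 (b i) (b j)
      rw [← h2, hlt j i hij] at h1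
      exact add_right_cancel h1
  · intro f
    obtain ⟨χ₀, hχ₀⟩ := LinearMap.BilinMap.toQuadraticMap_surjective (R := F) (M := V) (N := F) φ
    -- Adding `β v w - β w v` to a form does not change its diagonal.
    let β : LinearMap.BilinForm F V := Matrix.toBilin b
      (Matrix.of fun i j => if h : i < j then f ⟨(i, j), h⟩ - χ₀ (b i) (b j) else 0)
    have hβ : ∀ i j, β (b i) (b j) =
        if h : i < j then f ⟨(i, j), h⟩ - χ₀ (b i) (b j) else 0 := fun i j => by
      have := congrFun (congrFun (LinearMap.BilinForm.toMatrix_toBilin b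
        (Matrix.of fun i j => if h : i < j then f ⟨(i, j), h⟩ - χ₀ (b i) (b j) else 0)) i) j
      rwa [LinearMap.BilinForm.toMatrix_apply] at this
    refine ⟨⟨χ₀ + β - β.flip, fun v => ?_⟩, ?_⟩
    · have : χ₀ v v = φ v := by rw [← hχ₀]; rfl
      simp [this]
    · funext p
      have h1 := p.2
      simp [hβ, h1, h1.not_gt]

lemma card_lt_pairs (r : ℕ) :
    Nat.card {p : Fin r × Fin r // p.1 < p.2} = r.choose 2 := by
  rw [Nat.card_eq_fintype_card, Fintype.card_subtype, card_filter, ← univ_product_univ,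
    sum_product_right]
  simp only [← card_filter]
  have : ∀ j : Fin r, #{i : Fin r | i < j} = (j : ℕ) := fun j => by
    rw [Finset.filter_gt_eq_Iio, Fin.card_Iio]
  rw [sum_congr rfl fun j _ => this j, Fin.sum_univ_eq_sum_range (fun i => i), sum_range_id,
    Nat.choose_two_right]

variable [FiniteDimensional F V]

lemma card_diagForms (φ : QuadraticForm F V) :
    Nat.card (diagForms φ) = Nat.card F ^ (Module.finrank F V).choose 2 := by
  rw [Nat.card_congr (Equiv.ofBijective _
    (bijective_diagForms_entries (Module.finBasis F V) φ)), Nat.card_fun, card_lt_pairs]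

/-- The forms with diagonal `φ` whose left kernel contains a totally singular subspace `L`
correspond to the forms with diagonal `φ` on a complement of `L`. -/
lemma card_diagForms_le_ker (φ : QuadraticForm F V) {L : Submodule F V}
    (hL : IsTotallySingular φ L) :
    Nat.card {χ : diagForms φ // L ≤ LinearMap.ker χ.1} =
      Nat.card F ^ (Module.finrank F V - Module.finrank F L).choose 2 := by
  obtain ⟨C, hC⟩ := L.exists_isCompl
  have hfin := Submodule.finrank_add_eq_of_isCompl hC
  rw [← hfin, Nat.add_sub_cancel_left, ← card_diagForms (φ.comp C.subtype)]
  let π := C.projectionOnto L hC.symm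
  have hπL : ∀ v, v - π v ∈ L := fun v => by
    have h := Submodule.sub_projection_mem hC.symm v
    rwa [Submodule.projection_apply] at h
  refine Nat.card_congr ⟨fun χ => ⟨χ.1.1.compl₁₂ C.subtype C.subtype, fun v => χ.1.2 v⟩,
    fun ψ => ⟨⟨ψ.1.compl₁₂ π π + φ.polarBilin.compl₁₂ (C.subtype ∘ₗ π)
      (LinearMap.id - C.subtype ∘ₗ π), fun v => ?_⟩, fun v hv => ?_⟩, fun χ => ?_, fun ψ => ?_⟩
  · have h1 := ψ.2 (π v)
    have h2 := QuadraticMap.map_add φ (π v : V) (v - π v)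
    rw [add_sub_cancel, hL _ (hπL v)] at h2
    simp only [LinearMap.add_apply, LinearMap.compl₁₂_apply, h1]
    simp [h2]
  · have : π v = 0 := by simpa [π] using hv
    ext w
    simp [this]
  · ext v w
    have h1 : χ.1.1 (v - π v) = 0 := χ.2 (hπL v)
    have h2 : χ.1.1 (w - π w) = 0 := χ.2 (hπL w)
    have h3 := add_flip_of_mem_diagForms χ.1.2 (π v : V) (w - π w)
    rw [h2, LinearMap.zero_apply, add_zero] at h3
    have h4 : χ.1.1 v w = χ.1.1 (π v : V) w := by
      rw [← sub_eq_zero, ← LinearMap.sub_apply, ← map_sub, h1, LinearMap.zero_apply]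
    have h5 : χ.1.1 (π v : V) w = χ.1.1 (π v : V) (π w) + χ.1.1 (π v : V) (w - π w) := by
      rw [← map_add, add_sub_cancel]
    simp only [LinearMap.add_apply, LinearMap.compl₁₂_apply]
    rw [h4, h5, h3]
    rfl
  · ext v w
    have hv : π (v : V) = v := by simp [π]
    have hw : π (w : V) = w := by simp [π]
    simp [hv, hw]

end BilinearForms

/-! ### Nondegenerate forms and Wall forms -/

section WallForms

variable {F V : Type*} [Field F] [AddCommGroup V] [Module F V]

/-- The linearly independent `l`-tuples that span a totally singular subspace. -/
def singularTuples (Q : QuadraticForm F V) (l : ℕ) : Set (Fin l → V) :=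
  {s | LinearIndependent F s ∧ IsTotallySingular Q (Submodule.span F (Set.range s))}

/-- Inclusion–exclusion over the left kernel counts the nondegenerate forms with a given
diagonal. -/
lemma card_diagForms_ker_eq_bot [Finite F] [FiniteDimensional F V] (φ : QuadraticForm F V) {N : ℕ}
    (hN : Module.finrank F V ≤ N) :
    (Nat.card {χ : diagForms φ // LinearMap.ker χ.1 = ⊥} : ℚ) =
      ∑ l ∈ range (N + 1), (-1) ^ l / qProd (Nat.card F) l *
        ((Nat.card F : ℚ) ^ (Module.finrank F V - l).choose 2 * Nat.card (singularTuples φ l)) := by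
  classical
  have hq := one_lt_card F
  have : Finite V := Module.finite_of_finite F
  have : Finite (LinearMap.BilinForm F V) := Module.finite_of_finite F
  have := Fintype.ofFinite (diagForms φ)
  have h1 : ∀ χ : diagForms φ, (if LinearMap.ker χ.1 = ⊥ then 1 else 0 : ℚ) =
      ∑ l ∈ range (N + 1), (-1) ^ l / qProd (Nat.card F) l *
        (Nat.card {s : Fin l → V // LinearIndependent F s ∧
          Submodule.span F (Set.range s) ≤ LinearMap.ker χ.1} : ℚ) := by
    intro χ
    simp_rw [← Nat.card_congr (linearIndependentEquiv (LinearMap.ker χ.1)),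
      card_linearIndependent_eq]
    rw [sum_div_qProd_mul_prod hq ((LinearMap.ker χ.1).finrank_le.trans hN)]
    simp only [Submodule.finrank_eq_zero]
  have h2 : (Nat.card {χ : diagForms φ // LinearMap.ker χ.1 = ⊥} : ℚ) =
      ∑ χ : diagForms φ, if LinearMap.ker χ.1 = ⊥ then 1 else 0 := by
    rw [Nat.card_eq_fintype_card, Fintype.card_subtype, sum_boole]
  rw [h2, sum_congr rfl fun χ _ => h1 χ, sum_comm]
  refine sum_congr rfl fun l _ => ?_
  rw [← mul_sum]
  congr 1
  have := Fintype.ofFinite (Fin l → V)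
  have h3 : ∀ s : Fin l → V,
      Nat.card {χ : diagForms φ // LinearIndependent F s ∧
        Submodule.span F (Set.range s) ≤ LinearMap.ker χ.1} =
      if s ∈ singularTuples φ l then Nat.card F ^ (Module.finrank F V - l).choose 2 else 0 := by
    intro s
    split_ifs with h
    · rw [Nat.card_congr (Equiv.subtypeEquivRight fun χ => and_iff_right h.1),
        card_diagForms_le_ker φ h.2, finrank_span_eq_card h.1, Fintype.card_fin]
    · have : IsEmpty {χ : diagForms φ // LinearIndependent F s ∧
          Submodule.span F (Set.range s) ≤ LinearMap.ker χ.1} := ⟨fun χ => h ⟨χ.2.1, fun w hw => by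
        rw [← χ.1.2, LinearMap.mem_ker.1 (χ.2.2 hw), LinearMap.zero_apply]⟩⟩
      exact Nat.card_of_isEmpty
  rw [← Nat.cast_sum, sum_card_subtype_comm (fun (χ : diagForms φ) (s : Fin l → V) =>
      LinearIndependent F s ∧ Submodule.span F (Set.range s) ≤ LinearMap.ker χ.1),
    sum_congr rfl fun s _ => h3 s, sum_ite, sum_const_zero, add_zero, sum_const, smul_eq_mul,
    ← Fintype.card_subtype, ← Nat.card_eq_fintype_card, mul_comm]
  push_cast
  rfl

/-- The range of `1 - g`. -/
def moveRange (g : V ≃ₗ[F] V) : Submodule F V :=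
  LinearMap.range (LinearMap.id - g.toLinearMap)

lemma finrank_moveRange_add [FiniteDimensional F V] (g : V ≃ₗ[F] V) :
    Module.finrank F (moveRange g) + Module.finrank F (LinearMap.fixedSubmodule g.toLinearMap) =
      Module.finrank F V := by
  have h : LinearMap.fixedSubmodule g.toLinearMap =
      LinearMap.ker (LinearMap.id - g.toLinearMap) := by
    ext v
    simp only [LinearMap.mem_fixedSubmodule_iff, LinearMap.mem_ker, LinearMap.sub_apply,
      LinearMap.id_apply, sub_eq_zero]
    exact eq_comm
  rw [h, moveRange, LinearMap.finrank_range_add_finrank_ker]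

lemma polarBilin_map {Q : QuadraticForm F V} (g : orthogonalGroup Q) (x y : V) :
    Q.polarBilin (g.1 x) (g.1 y) = Q.polarBilin x y := by
  simp only [QuadraticMap.polarBilin_apply_apply, QuadraticMap.polar, ← map_add]
  rw [g.2, g.2, g.2]

lemma polarBilin_sub_map {Q : QuadraticForm F V} (g : orthogonalGroup Q) (x : V) :
    Q.polarBilin x (x - g.1 x) = Q (x - g.1 x) := by
  have h1 := QuadraticMap.map_add Q x (-g.1 x)
  have h2 : Q.polarBilin x (g.1 x) + QuadraticMap.polar Q x (-g.1 x) = 0 := by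
    rw [QuadraticMap.polar_neg_right, QuadraticMap.polarBilin_apply_apply, add_neg_cancel]
  have h3 : Q.polarBilin x x = 2 * Q x := by
    rw [QuadraticMap.polarBilin_apply_apply, QuadraticMap.polar_self, two_nsmul, two_mul]
  rw [QuadraticMap.map_neg, g.2, ← sub_eq_add_neg] at h1
  rw [map_sub, h1, h3]
  linear_combination -h2

lemma polarBilin_eq_zero_of_map_eq {Q : QuadraticForm F V} (g : orthogonalGroup Q) {z : V}
    (hz : g.1 z = z) (y : V) : Q.polarBilin z (y - g.1 y) = 0 := by
  rw [map_sub, sub_eq_zero, ← polarBilin_map g z y, hz]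

/-- A bilinear form `χ` on a subspace `W` that contains the range of `1 - g` is a Wall form of `g`
if `χ (x - g x) v = B x v`, where `B` is the polar form of `Q`. -/
def IsWallForm (Q : QuadraticForm F V) (g : V ≃ₗ[F] V) {W : Submodule F V}
    (χ : LinearMap.BilinForm F W) : Prop :=
  ∀ (x : V) (w : W), (w : V) = x - g x → ∀ v : W, χ w v = Q.polarBilin x v

lemma exists_isWallForm {Q : QuadraticForm F V} (hQ : Q.polarBilin.Nondegenerate)
    (g : orthogonalGroup Q) {W : Submodule F V} (hW : moveRange g.1 = W) :
    ∃ χ ∈ diagForms (Q.comp W.subtype), LinearMap.ker χ = ⊥ ∧ IsWallForm Q g.1 χ := by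
  subst hW
  obtain ⟨σ, hσ'⟩ : ∃ σ : moveRange g.1 →ₗ[F] V, ∀ w, σ w - g.1 (σ w) = w := by
    obtain ⟨σ, hσ⟩ :=
      (LinearMap.id - g.1.toLinearMap).rangeRestrict.exists_rightInverse_of_surjective
        (LinearMap.range_rangeRestrict _)
    exact ⟨σ, fun w => congrArg Subtype.val (LinearMap.congr_fun hσ w)⟩
  refine ⟨Q.polarBilin.compl₁₂ σ (moveRange g.1).subtype, fun w => ?_, ?_, fun x w hw v => ?_⟩
  · have h := polarBilin_sub_map g (σ w)
    rw [hσ'] at h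
    exact h
  · rw [LinearMap.ker_eq_bot']
    intro w hw
    -- A vector orthogonal to the range of `1 - g` is fixed by `g`.
    have h : ∀ y, Q.polarBilin (σ w - g.1 (σ w)) (g.1 y) = 0 := fun y => by
      have h1 : Q.polarBilin (σ w) (y - g.1 y) = 0 := LinearMap.congr_fun hw ⟨y - g.1 y, y, rfl⟩
      rw [map_sub, sub_eq_zero] at h1
      rw [map_sub, LinearMap.sub_apply, polarBilin_map, h1, sub_self]
    have h2 := hQ.1 (σ w - g.1 (σ w)) fun y => by simpa using h (g.1.symm y)
    rw [hσ'] at h2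
    exact Subtype.ext h2
  · obtain ⟨y, hy⟩ := v.2
    have hfix : g.1 (σ w - x) = σ w - x := by
      have := hσ' w
      rw [hw] at this
      rw [map_sub, sub_eq_sub_iff_sub_eq_sub, ← neg_sub, this, neg_sub]
    have h := polarBilin_eq_zero_of_map_eq g hfix y
    have hy' : (v : V) = y - g.1 y := hy.symm
    rw [← hy', map_sub, LinearMap.sub_apply, sub_eq_zero] at h
    exact h

lemma exists_isometry_isWallForm [FiniteDimensional F V] {Q : QuadraticForm F V}
    (hQ : Q.polarBilin.Nondegenerate) {W : Submodule F V} {χ : LinearMap.BilinForm F W}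
    (hχ : χ ∈ diagForms (Q.comp W.subtype)) (hker : LinearMap.ker χ = ⊥) :
    ∃ g : orthogonalGroup Q, moveRange g.1 = W ∧ IsWallForm Q g.1 χ := by
  let e : W ≃ₗ[F] Module.Dual F W :=
    LinearEquiv.ofInjectiveOfFinrankEq χ (LinearMap.ker_eq_bot.1 hker) Subspace.dual_finrank_eq.symm
  let ω : V →ₗ[F] W := e.symm.toLinearMap ∘ₗ W.subtype.dualMap ∘ₗ Q.polarBilin
  have hω : ∀ x (v : W), χ (ω x) v = Q.polarBilin x v := fun x v =>
    LinearMap.congr_fun (e.apply_symm_apply (W.subtype.dualMap (Q.polarBilin x))) v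
  let f : V →ₗ[F] V := LinearMap.id - W.subtype ∘ₗ ω
  have hf : ∀ x, f x = x - ω x := fun x => rfl
  have hfQ : ∀ x, Q (f x) = Q x := fun x => by
    have h1 := QuadraticMap.map_add Q x (-(ω x : V))
    have h2 : χ (ω x) (ω x) = Q (ω x) := hχ (ω x)
    rw [QuadraticMap.map_neg, QuadraticMap.polar_neg_right, ← QuadraticMap.polarBilin_apply_apply,
      ← hω, h2] at h1
    rw [hf, sub_eq_add_neg, h1]
    ring
  have hinj : Function.Injective f := by
    rw [← LinearMap.ker_eq_bot, LinearMap.ker_eq_bot']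
    intro x hx
    refine hQ.1 x fun y => ?_
    have h1 := hfQ (x + y)
    rw [map_add, hx, zero_add, QuadraticMap.map_add Q x y, hfQ, ← hfQ x, hx, map_zero] at h1
    simpa using h1
  refine ⟨⟨LinearEquiv.ofInjectiveEndo f hinj, hfQ⟩, ?_, fun x w hw v => ?_⟩
  · have hsurj : Function.Surjective ω := by
      refine e.symm.surjective.comp ?_
      have h1 : Function.Surjective Q.polarBilin := (LinearMap.BilinForm.toDual _ hQ).surjective
      exact (LinearMap.dualMap_surjective_of_injective W.injective_subtype).comp h1
    have h2 : LinearMap.id - f = W.subtype ∘ₗ ω := by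
      ext x
      simp [hf]
    change LinearMap.range (LinearMap.id - f) = W
    rw [h2, LinearMap.range_comp, LinearMap.range_eq_top.2 hsurj, Submodule.map_top,
      Submodule.range_subtype]
  · have : w = ω x := Subtype.ext (hw.trans (by
      change x - f x = _
      rw [hf, sub_sub_cancel]))
    rw [this, hω]

/-- Wall's parametrization of the isometries: those with range of `1 - g` equal to `W` correspond,
via the Wall form, to the nondegenerate bilinear forms on `W` with diagonal `Q`. -/
theorem card_moveRange_eq [FiniteDimensional F V] {Q : QuadraticForm F V}
    (hQ : Q.polarBilin.Nondegenerate) (W : Submodule F V) :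
    Nat.card {g : orthogonalGroup Q // moveRange g.1 = W} =
      Nat.card {χ : diagForms (Q.comp W.subtype) // LinearMap.ker χ.1 = ⊥} := by
  choose χ hdiag hker hwall using fun g : {g : orthogonalGroup Q // moveRange g.1 = W} =>
    exists_isWallForm hQ g.1 g.2
  refine Nat.card_congr (Equiv.ofBijective (fun g => ⟨⟨χ g, hdiag g⟩, hker g⟩) ⟨?_, ?_⟩)
  · intro g g' h
    have h : χ g = χ g' := congrArg (fun c => c.1.1) h
    have hmem : ∀ (g : {g : orthogonalGroup Q // moveRange g.1 = W}) x, x - g.1.1 x ∈ W :=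
      fun g x => g.2.le ⟨x, rfl⟩
    refine Subtype.ext (Subtype.ext (LinearEquiv.ext fun x => ?_))
    have h1 : χ g ⟨_, hmem g x⟩ = χ g ⟨_, hmem g' x⟩ := LinearMap.ext fun v => by
      rw [hwall g x _ rfl, h, hwall g' x _ rfl]
    have h2 := congrArg Subtype.val (LinearMap.ker_eq_bot.1 (hker g) h1)
    simpa using h2
  · rintro ⟨⟨ψ, hψ⟩, hψker⟩
    obtain ⟨g, hg, hgw⟩ := exists_isometry_isWallForm hQ hψ hψker
    refine ⟨⟨g, hg⟩, Subtype.ext (Subtype.ext (LinearMap.ext fun w => LinearMap.ext fun v => ?_))⟩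
    obtain ⟨x, hx⟩ : (w : V) ∈ moveRange g.1 := hg ▸ w.2
    exact (hwall ⟨g, hg⟩ x w hx.symm v).trans (hgw x w hx.symm v).symm

end WallForms

/-! ### The generating function of the isometries by rank -/

section GeneratingFunction

variable {F V : Type*} [Field F] [AddCommGroup V] [Module F V]

lemma card_singularTuples_comp_subtype (Q : QuadraticForm F V) (W : Submodule F V) (l : ℕ) :
    Nat.card (singularTuples (Q.comp W.subtype) l) =
      Nat.card {s : singularTuples Q l // Submodule.span F (Set.range s.1) ≤ W} := by
  have hts : ∀ t : Fin l → W, IsTotallySingular (Q.comp W.subtype)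
      (Submodule.span F (Set.range t)) ↔
      IsTotallySingular Q (Submodule.span F (Set.range fun i => (t i : V))) := by
    intro t
    have h : Submodule.span F (Set.range fun i => (t i : V)) =
        (Submodule.span F (Set.range t)).map W.subtype := by
      rw [Submodule.map_span, ← Set.range_comp]
      rfl
    rw [h]
    simp [IsTotallySingular, Submodule.mem_map]
  refine Nat.card_congr ⟨fun t => ⟨⟨fun i => t.1 i, ?_, ?_⟩, ?_⟩,
    fun s => ⟨fun i => ⟨s.1.1 i, s.2 (Submodule.subset_span ⟨i, rfl⟩)⟩, ?_, ?_⟩,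
    fun _ => rfl, fun _ => rfl⟩
  · exact t.2.1.map' W.subtype W.ker_subtype
  · exact (hts t.1).1 t.2.2
  · rw [Submodule.span_le]
    rintro _ ⟨i, rfl⟩
    exact (t.1 i).2
  · exact LinearIndependent.of_comp W.subtype s.1.2.1
  · exact (hts _).2 s.1.2.2

variable [Finite F] [FiniteDimensional F V]

/-- The generating function of the isometries by the rank of `1 - g`, in terms of the numbers of
totally singular tuples. -/
theorem sum_orthogonalGroup_pow {Q : QuadraticForm F V} (hQ : Q.polarBilin.Nondegenerate)
    [Fintype (orthogonalGroup Q)] (u : ℚ) :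
    ∑ g : orthogonalGroup Q, u ^ Module.finrank F (moveRange g.1) =
      ∑ l ∈ range (Module.finrank F V + 1), (-1) ^ l / qProd (Nat.card F) l *
        (Nat.card (singularTuples Q l) * (u ^ l *
          ∏ i ∈ range (Module.finrank F V - l), (1 + u * (Nat.card F : ℚ) ^ i))) := by
  classical
  have : Finite V := Module.finite_of_finite F
  have := Fintype.ofFinite (Submodule F V)
  have h1 : ∑ g : orthogonalGroup Q, u ^ Module.finrank F (moveRange g.1) =
      ∑ W : Submodule F V, u ^ Module.finrank F W *
        (Nat.card {χ : diagForms (Q.comp W.subtype) // LinearMap.ker χ.1 = ⊥} : ℚ) := by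
    rw [← sum_fiberwise_of_maps_to (t := univ) (g := fun g : orthogonalGroup Q => moveRange g.1)
      fun _ _ => mem_univ _]
    refine sum_congr rfl fun W _ => ?_
    rw [← card_moveRange_eq hQ, Nat.card_eq_fintype_card, Fintype.card_subtype,
      sum_congr rfl (g := fun _ => u ^ Module.finrank F W)
        fun g hg => by rw [(mem_filter.1 hg).2], sum_const, nsmul_eq_mul, mul_comm]
  rw [h1, sum_congr rfl fun W _ => by
    rw [card_diagForms_ker_eq_bot (Q.comp W.subtype) W.finrank_le, mul_sum], sum_comm]
  refine sum_congr rfl fun l _ => ?_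
  have := Fintype.ofFinite (singularTuples Q l)
  have h2 : ∀ W : Submodule F V, u ^ Module.finrank F W * ((-1) ^ l / qProd (Nat.card F) l *
      ((Nat.card F : ℚ) ^ (Module.finrank F W - l).choose 2 *
        Nat.card (singularTuples (Q.comp W.subtype) l))) =
      (-1) ^ l / qProd (Nat.card F) l * ∑ s : singularTuples Q l,
        if Submodule.span F (Set.range s.1) ≤ W then u ^ Module.finrank F W *
          (Nat.card F : ℚ) ^ (Module.finrank F W - l).choose 2 else 0 := by
    intro W
    rw [card_singularTuples_comp_subtype, Nat.card_eq_fintype_card (α := {s // _}),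
      Fintype.card_subtype, ← sum_filter, sum_const, nsmul_eq_mul]
    ring
  rw [sum_congr rfl fun W _ => h2 W, ← mul_sum, sum_comm]
  congr 1
  have h3 : ∀ s : singularTuples Q l, Module.finrank F (Submodule.span F (Set.range s.1)) = l :=
    fun s => by simpa using finrank_span_eq_card s.2.1
  rw [sum_congr rfl fun s _ => by rw [← sum_filter]]
  have h4 : ∀ s : singularTuples Q l, ∑ W : Submodule F V with Submodule.span F (Set.range s.1) ≤ W,
      u ^ Module.finrank F W * (Nat.card F : ℚ) ^ (Module.finrank F W - l).choose 2 =
      u ^ l * ∏ i ∈ range (Module.finrank F V - l), (1 + u * (Nat.card F : ℚ) ^ i) := fun s => by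
    have := sum_submodule_ge_pow (Submodule.span F (Set.range s.1)) u
    rwa [h3] at this
  rw [sum_congr rfl fun s _ => h4 s, sum_const, card_univ, ← Nat.card_eq_fintype_card,
    nsmul_eq_mul]

end GeneratingFunction

/-! ### Singular vectors off an orthogonal complement -/

section SingularVectors

variable {F V : Type*} [Field F] [AddCommGroup V] [Module F V]

/-- The orthogonal complement with respect to the polar form of `Q`. -/
abbrev polarPerp (Q : QuadraticForm F V) (Z : Submodule F V) : Submodule F V :=
  LinearMap.BilinForm.orthogonal Q.polarBilin Z

lemma mem_polarPerp_iff {Q : QuadraticForm F V} {Z : Submodule F V} {v : V} :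
    v ∈ polarPerp Q Z ↔ ∀ z ∈ Z, QuadraticMap.polar Q z v = 0 :=
  Iff.rfl

lemma le_polarPerp {Q : QuadraticForm F V} {Z : Submodule F V} (hZ : IsTotallySingular Q Z) :
    Z ≤ polarPerp Q Z := fun z hz => mem_polarPerp_iff.2 fun y hy => by
  have h := QuadraticMap.map_add Q y z
  rw [hZ _ (Z.add_mem hy hz), hZ _ hy, hZ _ hz] at h
  simpa using h.symm

variable [Finite F] [FiniteDimensional F V]

lemma card_mul_card_apply_eq {Z : Type*} [AddCommGroup Z] [Module F Z] [Finite Z]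
    {f : Z →ₗ[F] F} (hf : f ≠ 0) (c : F) :
    Nat.card F * Nat.card {z // f z = c} = Nat.card Z := by
  have := Fintype.ofFinite F
  obtain ⟨z₀, hz₀⟩ := (LinearMap.surjective hf) 1
  have h : ∀ b, Nat.card {z // f z = b} = Nat.card {z // f z = c} := fun b =>
    Nat.card_congr ((Equiv.addRight ((c - b) • z₀)).subtypeEquiv fun z => by
      simp [hz₀, ← eq_sub_iff_add_eq])
  rw [card_eq_sum_card_fiber f, sum_congr rfl fun b _ => h b, sum_const, card_univ, smul_eq_mul,
    Nat.card_eq_fintype_card]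

/-- Off the orthogonal complement of a totally singular subspace `Z`, the form is equidistributed
over `F`, because it is so on each coset of `Z`. -/
lemma card_mul_card_singular_not_mem_orthogonal {Q : QuadraticForm F V} {Z : Submodule F V}
    (hZ : IsTotallySingular Q Z) :
    Nat.card F * Nat.card {v : {v // v ∉ polarPerp Q Z} // Q v = 0} =
      Nat.card {v // v ∉ polarPerp Q Z} := by
  have : Finite V := Module.finite_of_finite F
  have := Fintype.ofFinite {v // v ∉ polarPerp Q Z}
  have := Fintype.ofFinite Z
  have h1 : ∀ v : {v // v ∉ polarPerp Q Z},
      Nat.card F * Nat.card {z : Z // Q (v + z) = 0} = Nat.card Z := by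
    intro v
    have hf : (Q.polarBilin v.1).comp Z.subtype ≠ 0 := by
      intro h
      refine v.2 ?_
      rw [LinearMap.BilinForm.mem_orthogonal_iff]
      intro y hy
      change QuadraticMap.polar Q y v.1 = 0
      rw [QuadraticMap.polar_comm]
      exact LinearMap.congr_fun h ⟨y, hy⟩
    rw [← card_mul_card_apply_eq hf (-Q v)]
    congr 1
    refine Nat.card_congr (Equiv.subtypeEquivRight fun z => ?_)
    rw [QuadraticMap.map_add Q, hZ z z.2, add_zero, add_comm, add_eq_zero_iff_eq_neg]
    rfl
  have h2 : ∀ z : Z, Nat.card {v : {v // v ∉ polarPerp Q Z} // Q (v + z) = 0} =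
      Nat.card {v : {v // v ∉ polarPerp Q Z} // Q v = 0} := by
    intro z
    exact Nat.card_congr (((Equiv.addRight (z : V)).subtypeEquiv fun v => not_congr
        (Submodule.add_mem_iff_left _ (le_polarPerp hZ z.2)).symm).subtypeEquiv fun v => Iff.rfl)
  have h3 := sum_card_subtype_comm
    (fun (v : {v // v ∉ polarPerp Q Z}) (z : Z) => Q (v + z) = 0)
  rw [sum_congr rfl fun z _ => h2 z, sum_const, card_univ, ← Nat.card_eq_fintype_card,
    smul_eq_mul] at h3
  have h4 := congrArg (Nat.card F * ·) h3
  simp only [mul_sum] at h4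
  rw [sum_congr rfl fun v _ => h1 v, sum_const, card_univ, ← Nat.card_eq_fintype_card,
    smul_eq_mul] at h4
  exact Nat.eq_of_mul_eq_mul_right (Nat.card_pos (α := Z)) (by rw [h4]; ring)

end SingularVectors

/-! ### Totally singular tuples -/

section TotallySingular

variable {F V : Type*} [Field F] [AddCommGroup V] [Module F V]

lemma isTotallySingular_span_singleton_sup {Q : QuadraticForm F V} {Z : Submodule F V} {v : V} :
    IsTotallySingular Q (Submodule.span F {v} ⊔ Z) ↔
      IsTotallySingular Q Z ∧ v ∈ polarPerp Q Z ∧ Q v = 0 := by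
  constructor
  · intro h
    have hZ : IsTotallySingular Q Z := fun z hz => h z (le_sup_right (a := Submodule.span F {v}) hz)
    have hv : v ∈ Submodule.span F {v} ⊔ Z :=
      le_sup_left (b := Z) (Submodule.mem_span_singleton_self v)
    refine ⟨hZ, mem_polarPerp_iff.2 fun z hz => ?_, h v hv⟩
    have h1 := QuadraticMap.map_add Q z v
    rw [hZ z hz, h v hv, h _ (Submodule.add_mem _ (le_sup_right (a := Submodule.span F {v}) hz) hv)]
      at h1
    simpa using h1.symm
  · rintro ⟨hZ, hperp, hv⟩ w hw
    obtain ⟨x, hx, z, hz, rfl⟩ := Submodule.mem_sup.1 hw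
    obtain ⟨c, rfl⟩ := Submodule.mem_span_singleton.1 hx
    have h1 := mem_polarPerp_iff.1 hperp z hz
    rw [QuadraticMap.map_add Q, QuadraticMap.map_smul, hv, hZ z hz, QuadraticMap.polar_smul_left,
      QuadraticMap.polar_comm, h1]
    simp

variable [FiniteDimensional F V]

lemma IsTotallySingular.finrank_le_wittIndex {Q : QuadraticForm F V} {Z : Submodule F V}
    (hZ : IsTotallySingular Q Z) : Module.finrank F Z ≤ wittIndex Q :=
  le_csSup ⟨Module.finrank F V, by rintro _ ⟨W, _, rfl⟩; exact W.finrank_le⟩ ⟨Z, hZ, rfl⟩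

lemma exists_finrank_eq_wittIndex (Q : QuadraticForm F V) :
    ∃ Z : Submodule F V, IsTotallySingular Q Z ∧ Module.finrank F Z = wittIndex Q :=
  Nat.sSup_mem (s := {d | ∃ W : Submodule F V, IsTotallySingular Q W ∧ Module.finrank F W = d})
    ⟨0, ⊥, by rintro w hw; rw [(Submodule.mem_bot F).1 hw, map_zero], by simp⟩
    ⟨Module.finrank F V, by rintro _ ⟨W, _, rfl⟩; exact W.finrank_le⟩

variable [Finite F]

/-- The number of singular vectors orthogonal to `Z`, in terms of that of all singular vectors. -/
lemma card_singular_sub_card_singular_perp {Q : QuadraticForm F V}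
    (hQ : Q.polarBilin.Nondegenerate) {Z : Submodule F V} (hZ : IsTotallySingular Q Z) :
    (Nat.card F : ℚ) * (Nat.card {v // Q v = 0} - Nat.card {v // v ∈ polarPerp Q Z ∧ Q v = 0}) =
      (Nat.card F : ℚ) ^ Module.finrank F V -
        (Nat.card F : ℚ) ^ (Module.finrank F V - Module.finrank F Z) := by
  classical
  have : Finite V := Module.finite_of_finite F
  have := Fintype.ofFinite V
  have h1 := card_mul_card_singular_not_mem_orthogonal hZ
  have h2 : Nat.card {v // v ∈ polarPerp Q Z} + Nat.card {v // v ∉ polarPerp Q Z} = Nat.card V := by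
    rw [Nat.card_eq_fintype_card, Nat.card_eq_fintype_card, Nat.card_eq_fintype_card,
      Fintype.card_subtype_compl, Nat.add_sub_cancel' (Fintype.card_subtype_le _)]
  have h3 : Nat.card {v // v ∈ polarPerp Q Z ∧ Q v = 0} +
      Nat.card {v : {v // v ∉ polarPerp Q Z} // Q v = 0} = Nat.card {v // Q v = 0} := by
    rw [Nat.card_congr (Equiv.subtypeSubtypeEquivSubtypeInter _ fun v => Q v = 0),
      Nat.card_eq_fintype_card, Nat.card_eq_fintype_card, Nat.card_eq_fintype_card,
      Fintype.card_subtype, Fintype.card_subtype, Fintype.card_subtype,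
      ← card_filter_add_card_filter_not (s := {v | Q v = 0}) (fun v => v ∈ polarPerp Q Z),
      filter_filter, filter_filter]
    simp only [and_comm]
  have h4 : Nat.card {v // v ∈ polarPerp Q Z} =
      Nat.card F ^ (Module.finrank F V - Module.finrank F Z) := by
    rw [← LinearMap.BilinForm.finrank_orthogonal hQ Z]
    exact Module.natCard_eq_pow_finrank
  have h5 : Nat.card V = Nat.card F ^ Module.finrank F V := Module.natCard_eq_pow_finrank
  rw [h4, h5] at h2
  have h1' := congrArg (Nat.cast : ℕ → ℚ) h1
  have h2' := congrArg (Nat.cast : ℕ → ℚ) h2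
  have h3' := congrArg (Nat.cast : ℕ → ℚ) h3
  push_cast at h1' h2' h3'
  linear_combination h1' + h2' - Nat.card F * h3'

/-- The number of singular vectors of a nondegenerate form of Witt index `a` in dimension
`a + b + 1`. -/
lemma card_singular {Q : QuadraticForm F V} (hQ : Q.polarBilin.Nondegenerate) {a b : ℕ}
    (ha : wittIndex Q = a) (hV : Module.finrank F V = a + b + 1) :
    (Nat.card {v // Q v = 0} : ℚ) =
      (Nat.card F : ℚ) ^ a + (Nat.card F : ℚ) ^ (a + b) - (Nat.card F : ℚ) ^ b := by
  have hq := zero_lt_one.trans (one_lt_card F)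
  obtain ⟨Z, hZ, hZa⟩ := exists_finrank_eq_wittIndex Q
  have h1 := card_singular_sub_card_singular_perp hQ hZ
  -- By maximality of `Z`, the singular vectors orthogonal to `Z` lie in `Z`.
  have h2 : ∀ v, v ∈ polarPerp Q Z ∧ Q v = 0 ↔ v ∈ Z := by
    refine fun v => ⟨fun hv => ?_, fun hv => ⟨le_polarPerp hZ hv, hZ v hv⟩⟩
    have h := (isTotallySingular_span_singleton_sup.2 ⟨hZ, hv⟩).finrank_le_wittIndex
    rw [← hZa] at h
    rw [Submodule.eq_of_le_of_finrank_le le_sup_right h]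
    exact le_sup_left (b := Z) (Submodule.mem_span_singleton_self v)
  have h3 : Nat.card {v // v ∈ polarPerp Q Z ∧ Q v = 0} = Nat.card F ^ a := by
    rw [Nat.card_congr (Equiv.subtypeEquivRight h2), ← ha, ← hZa]
    exact Module.natCard_eq_pow_finrank
  rw [h3, hZa, ha, hV, show a + b + 1 - a = b + 1 by omega] at h1
  push_cast at h1
  refine mul_left_cancel₀ hq.ne' ?_
  linear_combination h1

/-- The number of ways to extend a totally singular subspace `Z` by a further vector. -/
lemma card_singular_extension {Q : QuadraticForm F V} (hQ : Q.polarBilin.Nondegenerate) {a b : ℕ}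
    (ha : wittIndex Q = a) (hV : Module.finrank F V = a + b + 1) (hab : a ≤ b + 1)
    {Z : Submodule F V} (hZ : IsTotallySingular Q Z) :
    (Nat.card {v // (v ∈ polarPerp Q Z ∧ Q v = 0) ∧ v ∉ Z} : ℚ) =
      ((Nat.card F : ℚ) ^ a - (Nat.card F : ℚ) ^ Module.finrank F Z) *
        ((Nat.card F : ℚ) ^ (b - Module.finrank F Z) + 1) := by
  classical
  have hq := zero_lt_one.trans (one_lt_card F)
  have : Finite V := Module.finite_of_finite F
  have := Fintype.ofFinite V
  have h1 := card_singular_sub_card_singular_perp hQ hZ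
  rw [card_singular hQ ha hV] at h1
  have hla : Module.finrank F Z ≤ a := ha ▸ hZ.finrank_le_wittIndex
  have h2 : Nat.card {v // (v ∈ polarPerp Q Z ∧ Q v = 0) ∧ v ∉ Z} + Nat.card Z =
      Nat.card {v // v ∈ polarPerp Q Z ∧ Q v = 0} := by
    change _ + Nat.card {v // v ∈ Z} = _
    rw [Nat.card_eq_fintype_card, Nat.card_eq_fintype_card, Nat.card_eq_fintype_card,
      Fintype.card_subtype, Fintype.card_subtype, Fintype.card_subtype,
      ← card_filter_add_card_filter_not (s := {v | v ∈ polarPerp Q Z ∧ Q v = 0}) (fun v => v ∈ Z),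
      filter_filter, filter_filter, add_comm]
    congr 2
    ext v
    simp only [mem_filter, mem_univ, true_and]
    exact ⟨fun hv => ⟨⟨le_polarPerp hZ hv, hZ v hv⟩, hv⟩, fun hv => hv.2⟩
  have h3 : Nat.card Z = Nat.card F ^ Module.finrank F Z := Module.natCard_eq_pow_finrank
  rw [h3] at h2
  have h2' := congrArg (Nat.cast : ℕ → ℚ) h2
  push_cast at h2'
  generalize Module.finrank F Z = l at *
  rw [hV] at h1
  refine mul_left_cancel₀ hq.ne' ?_
  rcases le_or_gt l b with hlb | hlb
  · obtain ⟨c, rfl⟩ := Nat.exists_eq_add_of_le hlb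
    rw [show a + (l + c) + 1 - l = a + c + 1 by omega] at h1
    rw [Nat.add_sub_cancel_left]
    linear_combination (Nat.card F : ℚ) * h2' - h1
  · obtain rfl : l = b + 1 := by omega
    obtain rfl : a = b + 1 := by omega
    rw [show b + 1 + b + 1 - (b + 1) = b + 1 by omega] at h1
    linear_combination (Nat.card F : ℚ) * h2' - h1

lemma card_singularTuples {Q : QuadraticForm F V} (hQ : Q.polarBilin.Nondegenerate) {a b : ℕ}
    (ha : wittIndex Q = a) (hV : Module.finrank F V = a + b + 1) (hab : a ≤ b + 1) (l : ℕ) :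
    (Nat.card (singularTuples Q l) : ℚ) =
      ∏ i ∈ range l, (((Nat.card F : ℚ) ^ a - (Nat.card F : ℚ) ^ i) *
        ((Nat.card F : ℚ) ^ (b - i) + 1)) := by
  have : Finite V := Module.finite_of_finite F
  induction l with
  | zero =>
    have h : singularTuples Q 0 = Set.univ := by
      refine Set.eq_univ_of_forall fun s => ⟨linearIndependent_empty_type, ?_⟩
      rw [Set.range_eq_empty, Submodule.span_empty]
      rintro w hw
      rw [(Submodule.mem_bot F).1 hw, map_zero]
    rw [h]
    simp
  | succ l ih =>
    have := Fintype.ofFinite (singularTuples Q l)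
    have hcons : ∀ (s : Fin l → V) (v : V), Fin.cons v s ∈ singularTuples Q (l + 1) ↔
        s ∈ singularTuples Q l ∧
          (v ∈ polarPerp Q (Submodule.span F (Set.range s)) ∧ Q v = 0) ∧
            v ∉ Submodule.span F (Set.range s) := by
      intro s v
      simp only [singularTuples, Set.mem_ofPred_eq, linearIndependent_finCons, Fin.range_cons,
        Submodule.span_insert, isTotallySingular_span_singleton_sup]
      tauto
    have e : singularTuples Q (l + 1) ≃ Σ s : singularTuples Q l,
        {v // (v ∈ polarPerp Q (Submodule.span F (Set.range s.1)) ∧ Q v = 0) ∧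
          v ∉ Submodule.span F (Set.range s.1)} :=
      { toFun := fun t =>
          have h := (hcons (Fin.tail t.1) (t.1 0)).1 (by rw [Fin.cons_self_tail]; exact t.2)
          ⟨⟨Fin.tail t.1, h.1⟩, t.1 0, h.2⟩
        invFun := fun p => ⟨Fin.cons p.2.1 p.1.1, (hcons _ _).2 ⟨p.1.2, p.2.2⟩⟩
        left_inv := fun t => Subtype.ext (Fin.cons_self_tail t.1)
        right_inv := fun p => rfl }
    rw [Nat.card_congr e, Nat.card_sigma, Nat.cast_sum, sum_congr rfl fun s _ =>
      card_singular_extension hQ ha hV hab s.2.2, prod_range_succ, ← ih]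
    have h3 : ∀ s : singularTuples Q l, Module.finrank F (Submodule.span F (Set.range s.1)) = l :=
      fun s => by simpa using finrank_span_eq_card s.2.1
    rw [sum_congr rfl fun s _ => by rw [h3 s], sum_const, card_univ, ← Nat.card_eq_fintype_card,
      nsmul_eq_mul]

/-- The generating function of the isometries by the rank of `1 - g`. -/
theorem sum_orthogonalGroup_pow_finrank {Q : QuadraticForm F V}
    (hQ : Q.polarBilin.Nondegenerate) {a b : ℕ} (ha : wittIndex Q = a)
    (hV : Module.finrank F V = a + b + 1) (hab : a ≤ b + 1) [Fintype (orthogonalGroup Q)] (u : ℚ) :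
    ∑ g : orthogonalGroup Q, u ^ Module.finrank F (moveRange g.1) =
      rankPoly (Nat.card F) a b u := by
  have hq := one_lt_card F
  rw [sum_orthogonalGroup_pow hQ, rankPoly, hV]
  symm
  have h : ∀ l, (-1) ^ l * (gaussBinom (Nat.card F) a l * (Nat.card F : ℚ) ^ l.choose 2) * u ^ l *
      (∏ i ∈ range l, ((Nat.card F : ℚ) ^ (b - i) + 1)) *
        ∏ i ∈ range (a + b + 1 - l), (1 + u * (Nat.card F : ℚ) ^ i) =
      (-1) ^ l / qProd (Nat.card F) l * (Nat.card (singularTuples Q l) * (u ^ l *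
          ∏ i ∈ range (a + b + 1 - l), (1 + u * (Nat.card F : ℚ) ^ i))) := by
    intro l
    have := (qProd_pos hq l).ne'
    rw [card_singularTuples hQ ha hV hab, prod_mul_distrib, prod_pow_sub_pow hq]
    field_simp
  simp_rw [← h]
  refine sum_subset (range_mono (by omega)) fun l _ hl => ?_
  rw [gaussBinom_eq_zero_of_lt _ (by simpa using hl)]
  ring

end TotallySingular

/-! ### The distribution of the dimension of the fixed space -/

/-- The order of the isometry group, as given by the generating function at `1`. -/
lemma rankPoly_one {q : ℚ} (hq : 1 < q) {a b : ℕ} (hab : a ≤ b + 1) :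
    rankPoly q a b 1 = q ^ (a * b) * (∏ i ∈ range (b + 1), (1 + q ^ i)) * qProd q a := by
  simpa using rankPoly_inv_pow hq (Nat.zero_le a) hab

lemma two_mul_glOrder_eq {q : ℚ} (n : ℕ) :
    2 * glOrder (q ^ 2) (n + 1) =
      q ^ ((n + 1) * n) * (∏ i ∈ range (n + 1 + 1), (1 + q ^ i)) * qProd q (n + 1) := by
  have h1 : qProd (q ^ 2) (n + 1) = (∏ i ∈ range (n + 1), (1 + q ^ (i + 1))) * qProd q (n + 1) := by
    rw [qProd, qProd, ← prod_mul_distrib]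
    exact prod_congr rfl fun i _ => by ring
  have h2 : 2 * (n + 1).choose 2 = (n + 1) * n := by
    have : ((2 * (n + 1).choose 2 : ℕ) : ℚ) = (((n + 1) * n : ℕ) : ℚ) := by
      push_cast [Nat.cast_choose_two]
      ring
    exact_mod_cast this
  rw [prod_range_succ', glOrder, h1, ← pow_mul, h2]
  ring

lemma rankPoly_one_plus {q : ℚ} (hq : 1 < q) {n : ℕ} (hn : 1 ≤ n) :
    (q ^ n + 1) * rankPoly q n (n - 1) 1 = 2 * glOrder (q ^ 2) n := by
  obtain ⟨n, rfl⟩ := Nat.exists_eq_add_of_le' hn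
  rw [two_mul_glOrder_eq, rankPoly_one hq (by omega), Nat.add_sub_cancel,
    prod_range_succ _ (n + 1)]
  ring

lemma rankPoly_one_minus {q : ℚ} (hq : 1 < q) {n : ℕ} (hn : 1 ≤ n) :
    (q ^ n + -1) * rankPoly q (n - 1) n 1 = 2 * glOrder (q ^ 2) n := by
  obtain ⟨n, rfl⟩ := Nat.exists_eq_add_of_le' hn
  rw [two_mul_glOrder_eq, rankPoly_one hq (by omega), Nat.add_sub_cancel, qProd_succ]
  ring

lemma evenProb_self {q : ℚ} (hq : 1 < q) (n : ℕ) (e : ℚ) :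
    evenProb q n e n = (q ^ n + e) / (2 * glOrder (q ^ 2) n) := by
  rw [evenProb_eq hq le_rfl, show n + 1 - n = 1 by omega]
  simp
  ring

lemma card_GL_eq_glOrder {E : Type*} [Field E] [Finite E] (k : ℕ) :
    (Nat.card (Matrix.GeneralLinearGroup (Fin k) E) : ℚ) = glOrder (Nat.card E) k := by
  have := Fintype.ofFinite E
  rw [Matrix.card_GL_field, Nat.cast_prod, glOrder, Nat.card_eq_fintype_card,
    ← mul_one (_ * _), ← gaussBinom_self (Fintype.card E) k, ← prod_pow_sub_pow,
    ← Fin.prod_univ_eq_prod_range]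
  · refine prod_congr rfl fun i _ => ?_
    rw [Nat.cast_sub (Nat.pow_le_pow_right Fintype.card_pos i.2.le)]
    simp
  · exact_mod_cast Fintype.one_lt_card

lemma sum_range_two_mul_add_one (f : ℕ → ℚ) (n : ℕ) :
    ∑ k ∈ range (2 * n + 1), f k =
      ∑ k ∈ range (n + 1), f (2 * k) + ∑ k ∈ range n, f (2 * k + 1) := by
  induction n with
  | zero => simp
  | succ n ih =>
    rw [show 2 * (n + 1) + 1 = 2 * n + 1 + 1 + 1 by ring, sum_range_succ, sum_range_succ, ih,
      sum_range_succ (fun k => f (2 * k)) (n + 1), sum_range_succ (fun k => f (2 * k + 1)) n,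
      show 2 * (n + 1) = 2 * n + 1 + 1 by ring]
    ring

section Distribution

variable {F V : Type*} [Field F] [AddCommGroup V] [Module F V] [FiniteDimensional F V]

lemma sum_orthogonalGroup_eq_sum_fixedSpaceProb (Q : QuadraticForm F V)
    [Fintype (orthogonalGroup Q)] (h : ℕ → ℚ) :
    ∑ g : orthogonalGroup Q, h (Module.finrank F (LinearMap.fixedSubmodule g.1.toLinearMap)) =
      Fintype.card (orthogonalGroup Q) *
        ∑ k ∈ range (Module.finrank F V + 1), fixedSpaceProb Q k * h k := by
  classical
  rw [← sum_fiberwise_of_maps_to (t := range (Module.finrank F V + 1))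
    (g := fun g : orthogonalGroup Q =>
      Module.finrank F (LinearMap.fixedSubmodule g.1.toLinearMap))
    fun g _ => mem_range.2 (Nat.lt_succ_of_le (Submodule.finrank_le _)), mul_sum]
  refine sum_congr rfl fun k _ => ?_
  have hG : (Fintype.card (orthogonalGroup Q) : ℚ) ≠ 0 := by exact_mod_cast Fintype.card_ne_zero
  have hc : Nat.card {g : orthogonalGroup Q // Module.finrank F
      (LinearMap.fixedSubmodule (g : V ≃ₗ[F] V).toLinearMap) = k} =
      #{g : orthogonalGroup Q | Module.finrank F
        (LinearMap.fixedSubmodule (g : V ≃ₗ[F] V).toLinearMap) = k} := by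
    rw [Nat.card_eq_fintype_card, Fintype.card_subtype]
  rw [sum_congr rfl (g := fun _ => h k) fun g hg => by rw [(mem_filter.1 hg).2], sum_const,
    nsmul_eq_mul, fixedSpaceProb, hc, Nat.card_eq_fintype_card]
  field_simp

variable [Finite F]

/-- The moments of the dimension of the fixed space. -/
lemma sum_fixedSpaceProb_mul_pow {Q : QuadraticForm F V}
    (hQ : Q.polarBilin.Nondegenerate) {a b m : ℕ} (ha : wittIndex Q = a)
    (hV : Module.finrank F V = a + b + 1) (hab : a ≤ b + 1) (hma : m ≤ a) :
    ∑ k ∈ range (Module.finrank F V + 1), fixedSpaceProb Q k * ((Nat.card F : ℚ) ^ m) ^ k =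
      ∏ i ∈ range m, (1 + (Nat.card F : ℚ) ^ (i + 1)) := by
  have hq := one_lt_card F
  have : Finite V := Module.finite_of_finite F
  have : Finite (V →ₗ[F] V) := Module.finite_of_finite F
  have : Finite (V ≃ₗ[F] V) := Finite.of_injective _ LinearEquiv.toLinearMap_injective
  have := Fintype.ofFinite (orthogonalGroup Q)
  have hX : (Nat.card F : ℚ) ^ m ≠ 0 := pow_ne_zero _ (zero_lt_one.trans hq).ne'
  have h0 := sum_orthogonalGroup_pow_finrank hQ ha hV hab 1
  have h1 := sum_orthogonalGroup_pow_finrank hQ ha hV hab ((Nat.card F : ℚ) ^ m)⁻¹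
  have h2 := sum_orthogonalGroup_eq_sum_fixedSpaceProb Q fun k => ((Nat.card F : ℚ) ^ m) ^ k
  have h3 : ∑ g : orthogonalGroup Q, ((Nat.card F : ℚ) ^ m) ^
      (Module.finrank F (LinearMap.fixedSubmodule g.1.toLinearMap)) =
      ((Nat.card F : ℚ) ^ m) ^ (a + b + 1) *
        ∑ g : orthogonalGroup Q, ((Nat.card F : ℚ) ^ m)⁻¹ ^ Module.finrank F (moveRange g.1) := by
    rw [mul_sum]
    refine sum_congr rfl fun g _ => ?_
    rw [← hV, ← finrank_moveRange_add g.1, pow_add, inv_pow]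
    field_simp
  have hG : (Fintype.card (orthogonalGroup Q) : ℚ) ≠ 0 := by exact_mod_cast Fintype.card_ne_zero
  simp only [one_pow, sum_const, card_univ, nsmul_eq_mul, mul_one] at h0
  rw [rankPoly_one hq hab] at h0
  rw [rankPoly_inv_pow hq hma hab, ← h0] at h1
  rw [h3, h1] at h2
  refine mul_left_cancel₀ hG ?_
  rw [← h2, inv_pow]
  field_simp

/-- The signed moments of the dimension of the fixed space vanish. -/
lemma sum_fixedSpaceProb_mul_neg_pow {Q : QuadraticForm F V}
    (hQ : Q.polarBilin.Nondegenerate) {a b m : ℕ} (ha : wittIndex Q = a)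
    (hV : Module.finrank F V = a + b + 1) (hab : a ≤ b + 1) (hmb : m ≤ b) :
    ∑ k ∈ range (Module.finrank F V + 1), fixedSpaceProb Q k * (-(Nat.card F : ℚ) ^ m) ^ k = 0 := by
  have hq := one_lt_card F
  have : Finite V := Module.finite_of_finite F
  have : Finite (V →ₗ[F] V) := Module.finite_of_finite F
  have : Finite (V ≃ₗ[F] V) := Finite.of_injective _ LinearEquiv.toLinearMap_injective
  have := Fintype.ofFinite (orthogonalGroup Q)
  have hX : -(Nat.card F : ℚ) ^ m ≠ 0 := neg_ne_zero.2 (pow_ne_zero _ (zero_lt_one.trans hq).ne')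
  have h1 := sum_orthogonalGroup_pow_finrank hQ ha hV hab (-((Nat.card F : ℚ) ^ m)⁻¹)
  have h2 := sum_orthogonalGroup_eq_sum_fixedSpaceProb Q fun k => (-(Nat.card F : ℚ) ^ m) ^ k
  have h3 : ∑ g : orthogonalGroup Q, (-(Nat.card F : ℚ) ^ m) ^
      (Module.finrank F (LinearMap.fixedSubmodule g.1.toLinearMap)) =
      (-(Nat.card F : ℚ) ^ m) ^ (a + b + 1) *
        ∑ g : orthogonalGroup Q, (-((Nat.card F : ℚ) ^ m)⁻¹) ^ Module.finrank F (moveRange g.1) := by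
    rw [mul_sum]
    refine sum_congr rfl fun g _ => ?_
    rw [← hV, ← finrank_moveRange_add g.1, pow_add, ← inv_neg, inv_pow]
    field_simp
  have hG : (Fintype.card (orthogonalGroup Q) : ℚ) ≠ 0 := by exact_mod_cast Fintype.card_ne_zero
  rw [h3, h1, rankPoly_neg hq hmb, mul_zero] at h2
  exact (mul_eq_zero.1 h2.symm).resolve_left hG

/-- Only the identity fixes the whole space. -/
lemma fixedSpaceProb_finrank {Q : QuadraticForm F V}
    (hQ : Q.polarBilin.Nondegenerate) {a b : ℕ} (ha : wittIndex Q = a)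
    (hV : Module.finrank F V = a + b + 1) (hab : a ≤ b + 1) :
    fixedSpaceProb Q (Module.finrank F V) = 1 / rankPoly (Nat.card F) a b 1 := by
  have : Finite V := Module.finite_of_finite F
  have : Finite (V →ₗ[F] V) := Module.finite_of_finite F
  have : Finite (V ≃ₗ[F] V) := Finite.of_injective _ LinearEquiv.toLinearMap_injective
  have := Fintype.ofFinite (orthogonalGroup Q)
  have h0 := sum_orthogonalGroup_pow_finrank hQ ha hV hab 1
  simp only [one_pow, sum_const, card_univ, nsmul_eq_mul, mul_one] at h0
  have h1 : Nat.card {g : orthogonalGroup Q // Module.finrank F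
      (LinearMap.fixedSubmodule (g : V ≃ₗ[F] V).toLinearMap) = Module.finrank F V} = 1 := by
    rw [Nat.card_eq_one_iff_unique]
    refine ⟨⟨fun g g' => Subtype.ext (Subtype.ext (LinearEquiv.ext fun v => ?_))⟩, ⟨1, ?_⟩⟩
    · have hfix : ∀ g : {g : orthogonalGroup Q // Module.finrank F
          (LinearMap.fixedSubmodule (g : V ≃ₗ[F] V).toLinearMap) = Module.finrank F V},
          g.1.1 v = v := fun g => by
        have h : v ∈ LinearMap.fixedSubmodule g.1.1.toLinearMap := by
          rw [Submodule.eq_top_of_finrank_eq g.2]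
          trivial
        exact h
      rw [hfix, hfix]
    · have h : LinearMap.fixedSubmodule ((1 : orthogonalGroup Q) : V ≃ₗ[F] V).toLinearMap = ⊤ :=
        Submodule.eq_top_iff'.2 fun v => rfl
      rw [h, finrank_top]
  rw [fixedSpaceProb, h1, Nat.card_eq_fintype_card, h0, Nat.cast_one]

/-- The even and the odd part of the distribution of the dimension of the fixed space have the
same moments. -/
lemma sum_even_odd_fixedSpaceProb {Q : QuadraticForm F V}
    (hQ : Q.polarBilin.Nondegenerate) {a b n m : ℕ} (ha : wittIndex Q = a)
    (hV : Module.finrank F V = a + b + 1) (hab : a ≤ b + 1) (hn : a + b + 1 = 2 * n)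
    (hma : m ≤ a) (hmb : m ≤ b) :
    ∑ k ∈ range (n + 1), fixedSpaceProb Q (2 * k) * ((Nat.card F : ℚ) ^ (2 * m)) ^ k =
        (∏ i ∈ range m, (1 + (Nat.card F : ℚ) ^ (i + 1))) / 2 ∧
      (Nat.card F : ℚ) ^ m *
        ∑ k ∈ range n, fixedSpaceProb Q (2 * k + 1) * ((Nat.card F : ℚ) ^ (2 * m)) ^ k =
          (∏ i ∈ range m, (1 + (Nat.card F : ℚ) ^ (i + 1))) / 2 := by
  have h1 := sum_fixedSpaceProb_mul_pow hQ ha hV hab hma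
  have h2 := sum_fixedSpaceProb_mul_neg_pow hQ ha hV hab hmb
  rw [hV, hn, sum_range_two_mul_add_one] at h1 h2
  simp_rw [pow_succ _ (2 * _), pow_mul _ 2, neg_sq] at h2
  simp_rw [pow_succ _ (2 * _), pow_mul _ 2] at h1
  simp_rw [mul_comm 2 m, pow_mul]
  simp_rw [mul_neg, sum_neg_distrib] at h2
  rw [mul_sum]
  have h3 : ∑ k ∈ range n, (Nat.card F : ℚ) ^ m *
        (fixedSpaceProb Q (2 * k + 1) * (((Nat.card F : ℚ) ^ m) ^ 2) ^ k) =
      ∑ k ∈ range n, fixedSpaceProb Q (2 * k + 1) *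
        ((((Nat.card F : ℚ) ^ m) ^ 2) ^ k * (Nat.card F : ℚ) ^ m) :=
    sum_congr rfl fun k _ => by ring
  rw [h3]
  constructor <;> linarith

theorem fixedSpaceProb_odd {Q : QuadraticForm F V}
    (hQ : Q.polarBilin.Nondegenerate) {a b n : ℕ} (ha : wittIndex Q = a)
    (hV : Module.finrank F V = a + b + 1) (hab : a ≤ b + 1) (hn : a + b + 1 = 2 * n)
    (hna : n ≤ a + 1) (k : ℕ) :
    fixedSpaceProb Q (2 * k + 1) = oddProb (Nat.card F) n k := by
  have hq := one_lt_card F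
  rcases lt_or_ge k n with hk | hk
  · refine eq_of_sum_mul_pow_eq hq (f := fun k => fixedSpaceProb Q (2 * k + 1)) (fun m hm => ?_) hk
    have h1 := (sum_even_odd_fixedSpaceProb hQ ha hV hab hn (m := m) (by omega) (by omega)).2
    rw [← sum_oddProb_mul_pow hq hm] at h1
    exact mul_left_cancel₀ (pow_ne_zero _ (zero_lt_one.trans hq).ne') h1
  · rw [oddProb, Nat.sub_eq_zero_of_le hk, range_zero, sum_empty, mul_zero, fixedSpaceProb]
    have : IsEmpty {g : orthogonalGroup Q // Module.finrank F
        (LinearMap.fixedSubmodule (g : V ≃ₗ[F] V).toLinearMap) = 2 * k + 1} := ⟨fun g => by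
      have := Submodule.finrank_le (LinearMap.fixedSubmodule (g.1 : V ≃ₗ[F] V).toLinearMap)
      rw [g.2] at this
      omega⟩
    simp

theorem fixedSpaceProb_even {Q : QuadraticForm F V}
    (hQ : Q.polarBilin.Nondegenerate) {a b n : ℕ} (ha : wittIndex Q = a)
    (hV : Module.finrank F V = a + b + 1) (hab : a ≤ b + 1) (hn : a + b + 1 = 2 * n)
    (hna : n ≤ a + 1) {e : ℚ}
    (he : ((Nat.card F : ℚ) ^ n + e) * rankPoly (Nat.card F) a b 1 =
      2 * glOrder ((Nat.card F : ℚ) ^ 2) n) {k : ℕ} (hk : k ≤ n) :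
    fixedSpaceProb Q (2 * k) = evenProb (Nat.card F) n e k := by
  have hq := one_lt_card F
  have hG := glOrder_pos (one_lt_pow₀ hq two_ne_zero) n
  have htop : fixedSpaceProb Q (2 * n) = evenProb (Nat.card F) n e n := by
    have h0 : rankPoly (Nat.card F) a b 1 ≠ 0 := by
      intro h
      rw [h, mul_zero] at he
      linarith
    rw [← hn, ← hV, fixedSpaceProb_finrank hQ ha hV hab, evenProb_self hq, ← he, eq_comm]
    have h1 : (Nat.card F : ℚ) ^ n + e ≠ 0 := by
      intro h
      rw [h, zero_mul] at he
      linarith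
    field_simp
  rcases hk.eq_or_lt with rfl | hk
  · exact htop
  · refine eq_of_sum_mul_pow_eq hq (f := fun k => fixedSpaceProb Q (2 * k)) (fun m hm => ?_) hk
    have h1 := (sum_even_odd_fixedSpaceProb hQ ha hV hab hn (m := m) (by omega) (by omega)).1
    rw [← sum_evenProb_mul_pow hq hm e, sum_range_succ, sum_range_succ, htop] at h1
    exact add_right_cancel h1

end Distribution

end EvenOrthogonal

theorem theorem5p1 {F E V : Type*} [Field F] [Finite F] [CharP F 2] [Field E]
    [AddCommGroup V] [Module F V] [FiniteDimensional F V]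
    (q : ℕ) (hF : Nat.card F = q) (hE : Nat.card E = q ^ 2)
    (n : ℕ) (hn : 1 ≤ n) (Q : QuadraticForm F V) :
    (EvenOrthogonal.IsPlusType Q n → ∀ k ≤ n,
      EvenOrthogonal.fixedSpaceProb Q (2 * k) =
        (q : ℚ) ^ k / (2 * (Nat.card (GL (Fin k) E) : ℚ)) *
          ∑ j ∈ Finset.range (n - k + 1),
            (-1 : ℚ) ^ j / ((q : ℚ) ^ ((2 * (k : ℤ) - 1) * (j : ℤ)) *
              ∏ i ∈ Finset.Icc 1 j, ((q : ℚ) ^ (2 * i) - 1))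
        + 1 / 2 * ((-1 : ℚ) ^ (n - k) /
            ((q : ℚ) ^ (2 * k * (n - k)) * (Nat.card (GL (Fin k) E) : ℚ) *
              ∏ i ∈ Finset.Icc 1 (n - k), ((q : ℚ) ^ (2 * i) - 1)))) ∧
    (EvenOrthogonal.IsMinusType Q n → ∀ k ≤ n,
      EvenOrthogonal.fixedSpaceProb Q (2 * k) =
        (q : ℚ) ^ k / (2 * (Nat.card (GL (Fin k) E) : ℚ)) *
          ∑ j ∈ Finset.range (n - k + 1),
            (-1 : ℚ) ^ j / ((q : ℚ) ^ ((2 * (k : ℤ) - 1) * (j : ℤ)) *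
              ∏ i ∈ Finset.Icc 1 j, ((q : ℚ) ^ (2 * i) - 1))
        - 1 / 2 * ((-1 : ℚ) ^ (n - k) /
            ((q : ℚ) ^ (2 * k * (n - k)) * (Nat.card (GL (Fin k) E) : ℚ) *
              ∏ i ∈ Finset.Icc 1 (n - k), ((q : ℚ) ^ (2 * i) - 1)))) ∧
    (EvenOrthogonal.IsPlusType Q n ∨ EvenOrthogonal.IsMinusType Q n → ∀ k : ℕ,
      EvenOrthogonal.fixedSpaceProb Q (2 * k + 1) =
        1 / (2 * (q : ℚ) ^ k * (Nat.card (GL (Fin k) E) : ℚ)) *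
          ∑ j ∈ Finset.range (n - k),
            (-1 : ℚ) ^ j / ((q : ℚ) ^ (j ^ 2 + 2 * (k + 1) * j) *
              ∏ i ∈ Finset.Icc 1 j, (1 - 1 / (q : ℚ) ^ (2 * i)))) := by
  have hq1 : (1 : ℚ) < (q : ℚ) := hF ▸ EvenOrthogonal.one_lt_card F
  have : Finite E := Nat.finite_of_card_ne_zero (by
    rw [hE, ← hF]
    exact pow_ne_zero _ Nat.card_pos.ne')
  have hGL : ∀ k : ℕ, (Nat.card (GL (Fin k) E) : ℚ) = EvenOrthogonal.glOrder ((q : ℚ) ^ 2) k :=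
    fun k => by rw [EvenOrthogonal.card_GL_eq_glOrder, hE, Nat.cast_pow]
  simp only [hGL]
  refine ⟨fun h k hk => ?_, fun h k hk => ?_, ?_⟩
  · have h1 := EvenOrthogonal.fixedSpaceProb_even h.nondegenerate (b := n - 1) (n := n) (e := 1)
      h.wittIndex_eq (by rw [h.finrank_eq]; omega) (by omega) (by omega) (by omega)
      (by rw [hF]; exact EvenOrthogonal.rankPoly_one_plus hq1 hn) hk
    rw [h1, hF, EvenOrthogonal.evenProb, one_mul]
  · have hw := h.wittIndex_eq
    have h1 := EvenOrthogonal.fixedSpaceProb_even h.nondegenerate (a := n - 1) (b := n) (n := n)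
      (e := -1) (by omega) (by rw [h.finrank_eq]; omega) (by omega) (by omega) (by omega)
      (by rw [hF]; exact EvenOrthogonal.rankPoly_one_minus hq1 hn) hk
    rw [h1, hF, EvenOrthogonal.evenProb, neg_one_mul, ← sub_eq_add_neg]
  · rintro (h | h) k
    · have h1 := EvenOrthogonal.fixedSpaceProb_odd h.nondegenerate (b := n - 1) (n := n)
        h.wittIndex_eq (by rw [h.finrank_eq]; omega) (by omega) (by omega) (by omega) k
      rw [h1, hF, EvenOrthogonal.oddProb]
    · have hw := h.wittIndex_eq
      have h1 := EvenOrthogonal.fixedSpaceProb_odd h.nondegenerate (a := n - 1) (b := n) (n := n)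
        (by omega) (by rw [h.finrank_eq]; omega) (by omega) (by omega) (by omega) k
      rw [h1, hF, EvenOrthogonal.oddProb]
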